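/- For words $w,w'$ over an alphabet, let $\mathrm{LCS}(w,w')$ be the length of their longest common subsequence (a subsequence is obtained by deleting zero or more, not necessarily consecutive, symbols). Let $\mathrm{LCS}(t,[k]^n)$ be the minimum, over all families $w_1,\dots,w_t$ of $t$ (not necessarily distinct) words of length $n$ over the $k$-letter alphabet $[k]$, of $\max_{i\neq j}\mathrm{LCS}(w_i,w_j)$. There are absolute constants $0<C_1\le C_2$ such that for all integers $k\ge 2$ and $r\ge 1$ there is a real number $c$ with $C_1\,r^{-9}k^{1/r-2}\le c\le C_2\,r^{-9}k^{1/r-2}$ (that is, $c=\Theta(r^{-9}k^{1/r-2})$) such that for every integer $n\ge k(10r)^{9r}$, $$\mathrm{LCS}(r+k+2,[k]^n)\ \ge\ \frac nk+c\,n^{1-1/r}.$$ In the remaining case $r=0$, where the second term is absent, $\mathrm{LCS}(k+2,[k]^n)\ge \frac nk$ for all integers $n\ge k\ge 2$. -/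

import Mathlib

namespace CommonSubseq

/-- `pairLCS w w'` is the length of the longest common subsequence of the words `w` and `w'`.
A subsequence is obtained by deleting zero or more symbols, so it is a sublist. -/
noncomputable def pairLCS {α : Type*} (w w' : List α) : ℕ :=
  sSup {m : ℕ | ∃ u : List α, u.Sublist w ∧ u.Sublist w' ∧ u.length = m}

/-- For a family (multiset) of words `W i`, the maximum of `pairLCS (W i) (W j)` over all pairs
of distinct indices. -/
noncomputable def familyLCS {α ι : Type*} (W : ι → List α) : ℕ :=
  sSup {m : ℕ | ∃ i j : ι, i ≠ j ∧ pairLCS (W i) (W j) = m}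

/-- The minimum of `familyLCS W` over all families `W` of `t` words, with repetitions allowed,
taken from the set of words `F`. -/
noncomputable def minLCS {α : Type*} (t : ℕ) (F : Set (List α)) : ℕ :=
  sInf {m : ℕ | ∃ W : Fin t → List α, (∀ i, W i ∈ F) ∧ familyLCS W = m}

/-- All words of length `n` over the `k`-letter alphabet `Fin k`. -/
def words (k n : ℕ) : Set (List (Fin k)) :=
  {w | w.length = n}

/-- The supremum defining `pairLCS` is always an attained maximum. -/
theorem pairLCS_isGreatest {α : Type*} (w w' : List α) :
    IsGreatest {m : ℕ | ∃ u : List α, u.Sublist w ∧ u.Sublist w' ∧ u.length = m}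
      (pairLCS w w') := by
  have hne : {m : ℕ | ∃ u : List α, u.Sublist w ∧ u.Sublist w' ∧ u.length = m}.Nonempty :=
    ⟨0, [], List.nil_sublist _, List.nil_sublist _, rfl⟩
  have hb : BddAbove {m : ℕ | ∃ u : List α, u.Sublist w ∧ u.Sublist w' ∧ u.length = m} := by
    refine ⟨w.length, ?_⟩
    rintro m ⟨u, hu, -, rfl⟩
    exact hu.length_le
  exact ⟨Nat.sSup_mem hne hb, fun m hm => le_csSup hb hm⟩

/-- For a finite family of at least two words, the supremum defining `familyLCS` is an attained
maximum. -/
theorem familyLCS_isGreatest {α ι : Type*} [Finite ι] [Nontrivial ι] (W : ι → List α) :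
    IsGreatest {m : ℕ | ∃ i j : ι, i ≠ j ∧ pairLCS (W i) (W j) = m} (familyLCS W) := by
  have hne : {m : ℕ | ∃ i j : ι, i ≠ j ∧ pairLCS (W i) (W j) = m}.Nonempty := by
    obtain ⟨i, j, hij⟩ := exists_pair_ne ι
    exact ⟨_, i, j, hij, rfl⟩
  have hb : BddAbove {m : ℕ | ∃ i j : ι, i ≠ j ∧ pairLCS (W i) (W j) = m} := by
    refine Set.Finite.bddAbove ((Set.finite_range
      (fun p : ι × ι => pairLCS (W p.1) (W p.2))).subset ?_)
    rintro m ⟨i, j, -, rfl⟩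
    exact ⟨(i, j), rfl⟩
  exact ⟨Nat.sSup_mem hne hb, fun m hm => le_csSup hb hm⟩

/-- If the set of words is nonempty, the infimum defining `minLCS` is an attained minimum. -/
theorem minLCS_isLeast {α : Type*} (t : ℕ) {F : Set (List α)} (hF : F.Nonempty) :
    IsLeast {m : ℕ | ∃ W : Fin t → List α, (∀ i, W i ∈ F) ∧ familyLCS W = m} (minLCS t F) := by
  obtain ⟨w, hw⟩ := hF
  exact ⟨Nat.sInf_mem ⟨_, fun _ => w, fun _ => hw, rfl⟩, fun m hm => Nat.sInf_le hm⟩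

end CommonSubseq

/-! Two pigeonholes reduce the theorem to two letters. If more than `k` words have a letter
occurring at least `n/k + g/k` times, two of them share such a letter, and its power is a common
subsequence. Otherwise `r + 2` words have no such letter, so each of their letters occurs at least
`n/k - (k-1)g/k` times. Keeping `m` copies of each of two fixed letters gives balanced binary words,
and it suffices to find a pair with common subsequence of length `m + g` (`exists_pair_of_binary`).

For binary words, read each word as a walk with steps `±1`, and suppose that every pair stays below
`m + G`. Two walks that are both at least `G`, or both at most `-G`, at the same time would have a
long common subsequence consisting of a run of one letter and then a run of the other. So at every
time at least `r` walks lie in the strip `|h| < G`. A walk can stay in the strip only by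
oscillating, hence it has many peaks and valleys spread over the dyadic scales up to order `G`
(`exists_hasPeaks_of_inside`). Cut these scales into `r - 1` bins of `ξ` scales. Two of the `r`
walks have much of their oscillation in the same bin, hence at comparable scales
(`exists_close_scales`).

Opposing a peak of one word to a valley of the other makes the table of prefix LCS lengths grow on
cells whose letters differ (`IsProfile.rectangle`): common runs force more growth than the matched
cells can supply. Growth on mismatched cells near the diagonal in turn pushes the final LCS above
`m` (`IsProfile.slack`). Summing over windows of length `128 * G` and over all pairs gives a
contradiction once `m` is at least a constant times `r^5 * 2^ξ * G`. Since `2^ξ` is of order at most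
`G^(1/(r-1))`, this allows `G` of order `(m / r^5)^(1 - 1/r)`. -/

open Finset

namespace CommonSubseq

/-! ### Prefix tables of longest common subsequences -/

/-- The first `t` letters of an infinite word. -/
def wordPrefix {α : Type*} (w : ℕ → α) (t : ℕ) : List α := (List.range t).map w

theorem wordPrefix_succ {α : Type*} (w : ℕ → α) (t : ℕ) :
    wordPrefix w (t + 1) = wordPrefix w t ++ [w t] := by
  simp [wordPrefix, List.range_succ]

theorem le_pairLCS {α : Type*} {u w w' : List α} (h : u.Sublist w) (h' : u.Sublist w') :
    u.length ≤ pairLCS w w' :=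
  (pairLCS_isGreatest w w').2 ⟨u, h, h', rfl⟩

theorem exists_sublist_length_eq_pairLCS {α : Type*} (w w' : List α) :
    ∃ u : List α, u.Sublist w ∧ u.Sublist w' ∧ u.length = pairLCS w w' :=
  (pairLCS_isGreatest w w').1

theorem pairLCS_mono {α : Type*} {u u' w w' : List α} (h : u.Sublist w) (h' : u'.Sublist w') :
    pairLCS u u' ≤ pairLCS w w' := by
  obtain ⟨v, hv, hv', hl⟩ := exists_sublist_length_eq_pairLCS u u'
  rw [← hl]
  exact le_pairLCS (hv.trans h) (hv'.trans h')

theorem count_le_pairLCS {α : Type*} [DecidableEq α] (a : α) (w w' : List α) {c : ℕ}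
    (h : c ≤ w.count a) (h' : c ≤ w'.count a) : c ≤ pairLCS w w' := by
  have := le_pairLCS (List.replicate_sublist_iff.2 h) (List.replicate_sublist_iff.2 h')
  simpa using this

theorem dropLast_sublist_of_sublist_concat {α : Type*} {u l : List α} {a : α}
    (h : u.Sublist (l ++ [a])) : u.dropLast.Sublist l := by
  obtain ⟨l₁, l₂, rfl, h₁, h₂⟩ := List.sublist_append_iff.1 h
  rcases List.sublist_singleton.1 h₂ with rfl | rfl
  · simpa using (List.dropLast_sublist _).trans h₁
  · simpa using h₁

/-- The abstract properties of the table of lengths of longest common subsequences of the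
prefixes of two words. -/
structure IsProfile (w w' : ℕ → Bool) (U : ℕ → ℕ → ℤ) : Prop where
  mono_left : ∀ t r, U t r ≤ U (t + 1) r
  mono_right : ∀ t r, U t r ≤ U t (r + 1)
  diag : ∀ t r, w t = w' r → U t r + 1 ≤ U (t + 1) (r + 1)
  step : ∀ t r, U (t + 1) (r + 1) ≤ U t r + 1
  zero_left : ∀ r, U 0 r = 0
  zero_right : ∀ t, U t 0 = 0

/-- The growth estimates below use only these axioms, which are preserved by exchanging the two
words and by exchanging the two letters. -/
theorem isProfile_pairLCS (w w' : ℕ → Bool) :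
    IsProfile w w' (fun t r => (pairLCS (wordPrefix w t) (wordPrefix w' r) : ℤ)) := by
  constructor
  · intro t r
    simp only [wordPrefix_succ]
    exact_mod_cast pairLCS_mono (List.sublist_append_left _ _) (List.Sublist.refl _)
  · intro t r
    simp only [wordPrefix_succ]
    exact_mod_cast pairLCS_mono (List.Sublist.refl _) (List.sublist_append_left _ _)
  · intro t r h
    simp only [wordPrefix_succ, h]
    obtain ⟨u, hu, hu', hl⟩ := exists_sublist_length_eq_pairLCS (wordPrefix w t) (wordPrefix w' r)
    have := le_pairLCS (hu.append (List.Sublist.refl [w' r])) (hu'.append (List.Sublist.refl [w' r]))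
    rw [List.length_append, hl] at this
    exact_mod_cast this
  · intro t r
    simp only [wordPrefix_succ]
    obtain ⟨u, hu, hu', hl⟩ := exists_sublist_length_eq_pairLCS
      (wordPrefix w t ++ [w t]) (wordPrefix w' r ++ [w' r])
    have := le_pairLCS (dropLast_sublist_of_sublist_concat hu)
      (dropLast_sublist_of_sublist_concat hu')
    rw [List.length_dropLast, hl] at this
    omega
  · intro r
    obtain ⟨u, hu, hu', hl⟩ := exists_sublist_length_eq_pairLCS (wordPrefix w 0) (wordPrefix w' r)
    have := hu.length_le
    simp only [wordPrefix, List.range_zero, List.map_nil, List.length_nil] at this hl ⊢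
    omega
  · intro t
    obtain ⟨u, hu, hu', hl⟩ := exists_sublist_length_eq_pairLCS (wordPrefix w t) (wordPrefix w' 0)
    have := hu'.length_le
    simp only [wordPrefix, List.range_zero, List.map_nil, List.length_nil] at this hl ⊢
    omega

/-! ### Letter counts and balances -/

/-- The number of occurrences of `b` among the first `t` letters. -/
def letterCount (w : ℕ → Bool) (b : Bool) (t : ℕ) : ℤ := ∑ s ∈ range t, if w s = b then 1 else 0

/-- The number of `true`s minus the number of `false`s among the first `t` letters. -/
def balance (w : ℕ → Bool) (t : ℕ) : ℤ := ∑ s ∈ range t, if w s = true then 1 else -1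

@[simp] theorem letterCount_zero (w : ℕ → Bool) (b : Bool) : letterCount w b 0 = 0 := by
  simp [letterCount]

theorem letterCount_succ (w : ℕ → Bool) (b : Bool) (t : ℕ) :
    letterCount w b (t + 1) = letterCount w b t + if w t = b then 1 else 0 := by
  rw [letterCount, sum_range_succ, letterCount]

@[simp] theorem balance_zero (w : ℕ → Bool) : balance w 0 = 0 := by simp [balance]

theorem balance_succ (w : ℕ → Bool) (t : ℕ) :
    balance w (t + 1) = balance w t + if w t = true then 1 else -1 := by
  rw [balance, sum_range_succ, balance]

theorem two_mul_letterCount_true (w : ℕ → Bool) (t : ℕ) :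
    2 * letterCount w true t = t + balance w t := by
  induction t with
  | zero => simp
  | succ t ih => rw [letterCount_succ, balance_succ]; push_cast; split_ifs <;> linarith

theorem two_mul_letterCount_false (w : ℕ → Bool) (t : ℕ) :
    2 * letterCount w false t = t - balance w t := by
  induction t with
  | zero => simp
  | succ t ih =>
    rw [letterCount_succ, balance_succ]; push_cast
    cases w t <;> simp <;> linarith

theorem letterCount_mono (w : ℕ → Bool) (b : Bool) : Monotone (letterCount w b) := by
  apply monotone_nat_of_le_succ
  intro t
  rw [letterCount_succ]
  split_ifs <;> simp

theorem letterCount_nonneg (w : ℕ → Bool) (b : Bool) (t : ℕ) : 0 ≤ letterCount w b t := by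
  simpa using letterCount_mono w b (Nat.zero_le t)

theorem balance_flip (w : ℕ → Bool) (t : ℕ) : balance (fun s => !w s) t = -balance w t := by
  induction t with
  | zero => simp
  | succ t ih => rw [balance_succ, balance_succ, ih]; cases w t <;> simp <;> ring

namespace IsProfile

variable {w w' : ℕ → Bool} {U : ℕ → ℕ → ℤ}

theorem transpose (hU : IsProfile w w' U) : IsProfile w' w (fun t r => U r t) where
  mono_left t r := hU.mono_right r t
  mono_right t r := hU.mono_left r t
  diag t r h := hU.diag r t h.symm
  step t r := hU.step r t
  zero_left r := hU.zero_right r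
  zero_right t := hU.zero_left t

theorem flip (hU : IsProfile w w' U) : IsProfile (fun s => !w s) (fun s => !w' s) U where
  mono_left := hU.mono_left
  mono_right := hU.mono_right
  diag t r h := hU.diag t r (by simpa using h)
  step := hU.step
  zero_left := hU.zero_left
  zero_right := hU.zero_right

theorem mono (hU : IsProfile w w' U) {t t' r r' : ℕ} (ht : t ≤ t') (hr : r ≤ r') :
    U t r ≤ U t' r' :=
  (monotone_nat_of_le_succ (f := fun t => U t r) (fun t => hU.mono_left t r) ht).trans
    (monotone_nat_of_le_succ (f := U t') (fun r => hU.mono_right t' r) hr)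

theorem nonneg (hU : IsProfile w w' U) (t r : ℕ) : 0 ≤ U t r := by
  rw [← hU.zero_left r]
  exact hU.mono (Nat.zero_le _) le_rfl

/-- Appending a common run of a single letter. -/
theorem add_min_letterCount_le (hU : IsProfile w w' U) (b : Bool) {t t' r r' : ℕ}
    (ht : t ≤ t') (hr : r ≤ r') :
    U t r + min (letterCount w b t' - letterCount w b t)
      (letterCount w' b r' - letterCount w' b r) ≤ U t' r' := by
  obtain ⟨k, rfl⟩ := Nat.exists_eq_add_of_le ht
  obtain ⟨l, rfl⟩ := Nat.exists_eq_add_of_le hr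
  clear ht hr
  induction k generalizing l with
  | zero =>
    have := hU.mono (le_refl t) (Nat.le_add_right r l)
    have h2 : min (letterCount w b (t + 0) - letterCount w b t)
      (letterCount w' b (r + l) - letterCount w' b r) ≤ 0 := by simp
    simp only [add_zero] at *
    linarith
  | succ k ihk =>
    induction l with
    | zero =>
      have := hU.mono (Nat.le_add_right t (k + 1)) (le_refl r)
      have h2 : min (letterCount w b (t + (k + 1)) - letterCount w b t)
        (letterCount w' b (r + 0) - letterCount w' b r) ≤ 0 := by simp
      simp only [add_zero] at *
      linarith
    | succ l ihl =>
      have h1 := ihk (l + 1)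
      have h2 := ihk l
      have e1 := letterCount_succ w b (t + k)
      have e2 := letterCount_succ w' b (r + l)
      have m1 := hU.mono_left (t + k) (r + (l + 1))
      have m2 := hU.mono_right (t + (k + 1)) (r + l)
      have d := hU.diag (t + k) (r + l)
      simp only [← add_assoc] at *
      by_cases hw : w (t + k) = b
      · by_cases hw' : w' (r + l) = b
        · rw [if_pos hw] at e1
          rw [if_pos hw'] at e2
          have := d (hw.trans hw'.symm)
          rw [e1, e2, add_sub_right_comm, add_sub_right_comm, min_add_add_right]
          linarith
        · rw [if_neg hw', add_zero] at e2
          rw [e2]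
          linarith
      · rw [if_neg hw, add_zero] at e1
        rw [e1]
        linarith

end IsProfile

/-! ### The sweep inequality -/

/-- Change of variables: along the occurrences of `b`, the count before each occurrence takes the
values 0, 1, 2, ... once each. -/
theorem sum_letterCount (w : ℕ → Bool) (b : Bool) (f : ℤ → ℤ) (n : ℕ) :
    ∑ t ∈ range n, (if w t = b then f (letterCount w b t) else 0) =
      ∑ c ∈ range (letterCount w b n).toNat, f c := by
  induction n with
  | zero => simp
  | succ n ih =>
    rw [sum_range_succ, ih, letterCount_succ]
    have := letterCount_nonneg w b n
    split_ifs with h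
    · rw [Int.toNat_add this zero_le_one, Int.toNat_one, sum_range_succ, Int.toNat_of_nonneg this]
    · simp

theorem sum_letterCount_succ (w : ℕ → Bool) (b : Bool) (f : ℤ → ℤ) (n : ℕ) :
    ∑ t ∈ range n, (if w t = b then f (letterCount w b (t + 1)) else 0) =
      ∑ c ∈ range (letterCount w b n).toNat, f (c + 1) := by
  rw [← sum_letterCount w b (fun c => f (c + 1))]
  refine sum_congr rfl fun t _ => ?_
  split_ifs with h
  · rw [letterCount_succ, if_pos h]
  · rfl

theorem sum_indicator_top_le (m R : ℕ) :
    ∑ c ∈ range m, (if |(m : ℤ) - c| ≤ R then (1 : ℤ) else 0) ≤ R := by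
  rw [sum_boole]
  have : (range m).filter (fun c : ℕ => |(m : ℤ) - c| ≤ R) ⊆ Ico (m - R) m := by
    intro c hc
    simp only [mem_filter, mem_range, mem_Ico, abs_le] at hc ⊢
    omega
  have := card_le_card this
  rw [Nat.card_Ico] at this
  omega

theorem sum_indicator_near_ge (m R : ℕ) :
    (2 * R + 1) * ((m : ℤ) - 2 * R) ≤
      ∑ c ∈ range m, ∑ c' ∈ range m, (if |(c' : ℤ) - c| ≤ R then (1 : ℤ) else 0) := by
  rcases le_total m (2 * R) with h | h
  · refine le_trans ?_ (sum_nonneg fun c _ => sum_nonneg fun c' _ => by split_ifs <;> simp)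
    have : (m : ℤ) ≤ 2 * R := by exact_mod_cast h
    nlinarith
  · calc (2 * R + 1) * ((m : ℤ) - 2 * R) = ∑ c ∈ Ico R (m - R), (2 * (R : ℤ) + 1) := by
          rw [sum_const, Nat.card_Ico, nsmul_eq_mul, Nat.cast_sub (by omega),
            Nat.cast_sub (by omega)]
          ring
      _ ≤ ∑ c ∈ Ico R (m - R), ∑ c' ∈ range m, (if |(c' : ℤ) - c| ≤ R then (1 : ℤ) else 0) := by
          refine sum_le_sum fun c hc => ?_
          rw [mem_Ico] at hc
          rw [sum_boole]
          have : Icc (c - R) (c + R) ⊆ (range m).filter (fun c' : ℕ => |(c' : ℤ) - c| ≤ R) := by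
            intro c' hc'
            simp only [mem_filter, mem_range, mem_Icc, abs_le] at hc' ⊢
            omega
          have := card_le_card this
          rw [Nat.card_Icc] at this
          omega
      _ ≤ _ := by
          refine sum_le_sum_of_subset_of_nonneg ?_ ?_
          · intro c hc
            simp only [mem_range, mem_Ico] at hc ⊢
            omega
          · intro c _ _
            exact sum_nonneg fun c' _ => by split_ifs <;> simp

/-- The increment of a profile over a cell in which the two letters differ. -/
def mismatchInc (w w' : ℕ → Bool) (U : ℕ → ℕ → ℤ) (t r : ℕ) : ℤ :=
  if w t ≠ w' r then U (t + 1) (r + 1) - U t r else 0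

namespace IsProfile

variable {w w' : ℕ → Bool} {U : ℕ → ℕ → ℤ}

/-- The sweep inequality for a single letter `b` in a band of half-width `R`. -/
theorem slack_letter (hU : IsProfile w w' U) (b : Bool) (R m n : ℕ)
    (hm : letterCount w b n = m) (hm' : letterCount w' b n = m) :
    (2 * R + 1) * ((m : ℤ) - 2 * R)
      + ∑ t ∈ range n, ∑ r ∈ range n,
        ((if w t = b ∧ w' r ≠ b ∧ |letterCount w' b r - letterCount w b t| ≤ R then
            U t (r + 1) - U t r else 0) +
          (if w t ≠ b ∧ w' r = b ∧ |letterCount w' b (r + 1) - letterCount w b t| ≤ R then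
            U (t + 1) (r + 1) - U t (r + 1) else 0))
      ≤ (2 * R + 1) * U n n := by
  set x := letterCount w b with hx
  set x' := letterCount w' b with hx'
  set g : ℕ → ℕ → ℤ := fun t r => if |x' r - x t| ≤ R then U t r else 0 with hg
  -- `S t` adds the table entries just after each `b` of `w'`, inside a band measured by counts of
  -- `b`; `N t` is the number of `b`s of `w'` in the band. The sweep follows `S` from `t = 0` to `t
  -- = n`.
  set S : ℕ → ℤ := fun t => ∑ r ∈ range n, if w' r = b then g t (r + 1) else 0 with hS
  set N : ℕ → ℤ := fun t =>
    ∑ r ∈ range n, if w' r = b then (if |x' r - x t| ≤ R then 1 else 0) else 0 with hN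
  have hsweep : ∀ t ∈ range n,
      (if w t = b then N t else 0) - (if w t = b then g t n else 0) +
      ∑ r ∈ range n,
        ((if w t = b ∧ w' r ≠ b ∧ |x' r - x t| ≤ R then U t (r + 1) - U t r else 0) +
          (if w t ≠ b ∧ w' r = b ∧ |x' (r + 1) - x t| ≤ R then
            U (t + 1) (r + 1) - U t (r + 1) else 0)) ≤ S (t + 1) - S t := by
    intro t _
    by_cases hw : w t = b
    · have hxt : x (t + 1) = x t + 1 := by rw [hx, letterCount_succ, if_pos hw]
      -- When `w t = b`, the band moves by one `b` together with the diagonal, so `diag` gains 1 at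
      -- each of the `N t` positions. The row telescopes because `U t 0 = 0`, which leaves exactly
      -- the increments at letters of `w'` other than `b`.
      have htel : g t n = ∑ r ∈ range n, (g t (r + 1) - g t r) := by
        rw [sum_range_sub]
        simp [hg, hU.zero_right]
      simp only [hw, if_true, true_and, ne_eq, not_true_eq_false, false_and, if_false, add_zero]
      rw [htel, hN, hS, ← sum_sub_distrib, ← sum_sub_distrib, ← sum_add_distrib]
      refine sum_le_sum fun r _ => ?_
      by_cases hw' : w' r = b
      · have hxr : x' (r + 1) = x' r + 1 := by rw [hx', letterCount_succ, if_pos hw']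
        have hd := hU.diag t r (hw.trans hw'.symm)
        simp only [hw', if_true, not_true_eq_false, false_and, if_false, hg, hxt, hxr,
          add_sub_add_right_eq_sub]
        split_ifs <;> linarith
      · have hxr : x' (r + 1) = x' r := by rw [hx', letterCount_succ, if_neg hw', add_zero]
        simp only [hw', if_false, not_false_eq_true, true_and, hg, hxr]
        split_ifs <;> linarith
    · have hxt : x (t + 1) = x t := by rw [hx, letterCount_succ, if_neg hw, add_zero]
      simp only [hw, if_false, false_and, zero_add, ne_eq, not_false_eq_true, true_and, sub_zero]
      rw [hS, ← sum_sub_distrib]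
      refine sum_le_sum fun r _ => ?_
      by_cases hw' : w' r = b
      · simp only [hw', if_true, true_and, hg, hxt]
        split_ifs <;> linarith
      · simp only [hw', if_false, false_and]
        linarith
  have hsum := sum_le_sum hsweep
  rw [sum_range_sub, sum_add_distrib, sum_sub_distrib] at hsum
  have hS0 : S 0 = 0 := by simp [hS, hg, hU.zero_left]
  have hUn := hU.nonneg n n
  -- On the last row the band holds at most `R + 1` entries just after a `b`, and on the last column
  -- at most `R` entries (`hgn`). Together they give the factor `2 * R + 1`, the full width of the
  -- band.
  have hSn : S n ≤ (R + 1) * U n n := by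
    calc S n ≤ ∑ r ∈ range n,
          if w' r = b then (fun c : ℤ => if |c - m| ≤ R then U n n else 0) (x' (r + 1)) else 0 := by
          refine sum_le_sum fun r hr => ?_
          rw [mem_range] at hr
          have := hU.mono (le_refl n) (Nat.succ_le_of_lt hr)
          simp only [hg, hm]
          split_ifs <;> first | exact this | exact le_rfl
      _ = ∑ c ∈ range m, if |(m : ℤ) - (c + 1)| ≤ R then U n n else 0 := by
          rw [hx', sum_letterCount_succ w' b (fun c : ℤ => if |c - m| ≤ R then U n n else 0),
            ← hx', hm', Int.toNat_natCast]
          simp only [abs_sub_comm (m : ℤ)]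
      _ ≤ ∑ c ∈ range (m + 1), if |(m : ℤ) - c| ≤ R then U n n else 0 := by
          rw [sum_range_succ']
          push_cast
          have : (0 : ℤ) ≤ if |(m : ℤ) - 0| ≤ R then U n n else 0 := by
            split_ifs <;> simp [hUn]
          linarith
      _ = (∑ c ∈ range (m + 1), if |(m : ℤ) - c| ≤ R then 1 else 0) * U n n := by
          rw [sum_mul]
          refine sum_congr rfl fun c _ => ?_
          split_ifs <;> simp
      _ ≤ (R + 1) * U n n := by
          refine mul_le_mul_of_nonneg_right ?_ hUn
          rw [sum_range_succ]
          have := sum_indicator_top_le m R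
          simp only [sub_self, abs_zero, Nat.cast_nonneg, if_true]
          linarith
  have hgn : ∑ t ∈ range n, (if w t = b then g t n else 0) ≤ R * U n n := by
    calc ∑ t ∈ range n, (if w t = b then g t n else 0) ≤ ∑ t ∈ range n,
          if w t = b then (fun c : ℤ => if |m - c| ≤ R then U n n else 0) (x t) else 0 := by
          refine sum_le_sum fun t ht => ?_
          rw [mem_range] at ht
          have := hU.mono ht.le (le_refl n)
          simp only [hg, hm']
          split_ifs <;> first | exact this | exact le_rfl
      _ = ∑ c ∈ range m, if |(m : ℤ) - c| ≤ R then U n n else 0 := by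
          rw [hx, sum_letterCount w b (fun c : ℤ => if |m - c| ≤ R then U n n else 0), ← hx, hm,
            Int.toNat_natCast]
      _ = (∑ c ∈ range m, if |(m : ℤ) - c| ≤ R then 1 else 0) * U n n := by
          rw [sum_mul]
          refine sum_congr rfl fun c _ => ?_
          split_ifs <;> simp
      _ ≤ R * U n n := mul_le_mul_of_nonneg_right (sum_indicator_top_le m R) hUn
  have hNs : (2 * R + 1) * ((m : ℤ) - 2 * R) ≤ ∑ t ∈ range n, (if w t = b then N t else 0) := by
    refine (sum_indicator_near_ge m R).trans (le_of_eq ?_)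
    have e1 : ∀ t, N t = (fun c : ℤ => ∑ c' ∈ range m, if |(c' : ℤ) - c| ≤ R then (1 : ℤ) else 0)
        (x t) := by
      intro t
      rw [hN]
      simp only
      rw [hx', sum_letterCount w' b (fun c : ℤ => if |c - x t| ≤ R then 1 else 0), ← hx', hm',
        Int.toNat_natCast]
    simp only [e1]
    rw [hx, sum_letterCount w b
      (fun c : ℤ => ∑ c' ∈ range m, if |(c' : ℤ) - c| ≤ R then (1 : ℤ) else 0), ← hx, hm,
      Int.toNat_natCast]
  linarith

theorem mismatchInc_nonneg (hU : IsProfile w w' U) (t r : ℕ) : 0 ≤ mismatchInc w w' U t r := by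
  unfold mismatchInc
  split_ifs
  · linarith [hU.mono (Nat.le_succ t) (Nat.le_succ r)]
  · exact le_rfl

/-- If all cells of `Z` lie in the band of half-width `R`, then the increments over mismatched
cells of `Z` push the longest common subsequence above `m`. -/
theorem slack (hU : IsProfile w w' U) (R m n : ℕ)
    (hm : ∀ b, letterCount w b n = m) (hm' : ∀ b, letterCount w' b n = m)
    (Z : Finset (ℕ × ℕ)) (hZn : Z ⊆ range n ×ˢ range n)
    (hZ : ∀ z ∈ Z, ∀ b, |letterCount w' b z.2 - letterCount w b z.1| ≤ R ∧
      |letterCount w' b (z.2 + 1) - letterCount w b z.1| ≤ R) :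
    (4 * R + 2) * ((m : ℤ) - 2 * R) + ∑ z ∈ Z, mismatchInc w w' U z.1 z.2 ≤
      (4 * R + 2) * U n n := by
  have h1 := hU.slack_letter true R m n (hm _) (hm' _)
  have h2 := hU.slack_letter false R m n (hm _) (hm' _)
  set F : Bool → ℕ → ℕ → ℤ := fun b t r =>
    ((if w t = b ∧ w' r ≠ b ∧ |letterCount w' b r - letterCount w b t| ≤ R then
            U t (r + 1) - U t r else 0) +
          (if w t ≠ b ∧ w' r = b ∧ |letterCount w' b (r + 1) - letterCount w b t| ≤ R then
            U (t + 1) (r + 1) - U t (r + 1) else 0)) with hF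
  have hF0 : ∀ b t r, 0 ≤ F b t r := by
    intro b t r
    have a1 := hU.mono_right t r
    have a2 := hU.mono_left t (r + 1)
    simp only [hF]
    split_ifs <;> linarith
  have key : ∑ z ∈ Z, mismatchInc w w' U z.1 z.2 ≤
      ∑ t ∈ range n, ∑ r ∈ range n, (F true t r + F false t r) := by
    rw [← sum_product' (range n) (range n) (fun t r => F true t r + F false t r)]
    refine le_trans (sum_le_sum fun z hz => ?_)
      (sum_le_sum_of_subset_of_nonneg hZn fun z _ _ => add_nonneg (hF0 _ _ _) (hF0 _ _ _))
    have ht := hZ z hz true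
    have hf := hZ z hz false
    simp only [hF, mismatchInc]
    -- On a mismatched cell, the sweep for the letter `w t` sees the step from `(t, r)` to `(t, r +
    -- 1)`, and the sweep for the other letter sees the step from there to `(t + 1, r + 1)`. The two
    -- add up to the whole increment of the cell.
    cases hw : w z.1 <;> cases hw' : w' z.2 <;>
      simp [ht.1, ht.2, hf.1, hf.2]
  simp only [sum_add_distrib] at key
  change _ + ∑ t ∈ range n, ∑ r ∈ range n, F true t r ≤ _ at h1
  change _ + ∑ t ∈ range n, ∑ r ∈ range n, F false t r ≤ _ at h2
  linarith

end IsProfile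

/-! ### Excursions and the rectangle inequality -/

/-- `h` returns at `b` to its value at `a` and does not go below this value in between. -/
structure IsExcursion (h : ℕ → ℤ) (a b : ℕ) : Prop where
  le : a ≤ b
  eq : h b = h a
  ge : ∀ t, a ≤ t → t ≤ b → h a ≤ h t

/-- Each diagonal telescopes to its end value minus its start value. The three sums collect the
diagonals from the side `j = 0` to the side `i = p`, those ending on `j = q`, and the remaining
ones, which cross from `i = 0` to `i = p`. -/
theorem sum_diagonal_increments (f : ℕ → ℕ → ℤ) {p q : ℕ} (hpq : p ≤ q) :
    ∑ i ∈ range p, ∑ j ∈ range q, (f (i + 1) (j + 1) - f i j) =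
      ∑ k ∈ range p, (f p k - f (p - k) 0) + ∑ k ∈ range p, (f (k + 1) q - f 0 (q - (k + 1))) +
        ∑ j ∈ range (q - p), (f p (p + j) - f 0 j) := by
  have e1 : ∑ i ∈ range p, ∑ j ∈ range q, (f (i + 1) (j + 1) - f i j) =
      ∑ i ∈ range p, (f (i + 1) q - f (i + 1) 0) + ∑ j ∈ range q, (f p j - f 0 j) := by
    have h1 : ∀ j, f p j - f 0 j = ∑ i ∈ range p, (f (i + 1) j - f i j) := fun j => by
      rw [sum_range_sub (fun i => f i j)]
    have h2 : ∀ i, f (i + 1) q - f (i + 1) 0 =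
        ∑ j ∈ range q, (f (i + 1) (j + 1) - f (i + 1) j) := fun i => by
      rw [sum_range_sub (fun j => f (i + 1) j)]
    simp only [h1, h2]
    rw [sum_comm (s := range q), ← sum_add_distrib]
    refine sum_congr rfl fun i _ => ?_
    rw [← sum_add_distrib]
    exact sum_congr rfl fun j _ => by ring
  obtain ⟨d, rfl⟩ := Nat.exists_eq_add_of_le hpq
  have r1 : ∑ k ∈ range p, f (p - k) 0 = ∑ k ∈ range p, f (k + 1) 0 := by
    rw [← sum_range_reflect]
    refine sum_congr rfl fun k hk => ?_
    rw [mem_range] at hk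
    congr 1
    omega
  have r2 : ∑ j ∈ range (p + d), f p j = ∑ j ∈ range p, f p j + ∑ j ∈ range d, f p (p + j) := by
    rw [sum_range_add]
  have r3 : ∑ j ∈ range (p + d), f 0 j =
      ∑ j ∈ range d, f 0 j + ∑ k ∈ range p, f 0 (p + d - (k + 1)) := by
    rw [add_comm p d, sum_range_add, ← sum_range_reflect (fun j => f 0 (d + j))]
    congr 1
    refine sum_congr rfl fun k hk => ?_
    rw [mem_range] at hk
    congr 1
    omega
  rw [e1]
  simp only [sum_sub_distrib, Nat.add_sub_cancel_left]
  linarith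

namespace IsProfile

variable {w w' : ℕ → Bool} {U : ℕ → ℕ → ℤ}

/-- The total increment over the rectangle is computed along diagonals and compared with the
contribution of matched cells. The end of a positive excursion and the start of a negative one are
both rich in `false`; the start of the former and the end of the latter are both rich in `true`. The
resulting common runs make the short diagonals grow by more than half their length, and this surplus
must come from mismatched cells. -/
theorem rectangle_aux (hU : IsProfile w w' U) {a c p q : ℕ} (hpq : p ≤ q)
    (hI : IsExcursion (balance w) a (a + p)) (hJ : IsExcursion (fun r => -balance w' r) c (c + q)) :
    ∑ k ∈ range p, (min (balance w (a + p - k) - balance w a) (balance w' c - balance w' (c + k))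
      + min (balance w (a + k) - balance w a) (balance w' c - balance w' (c + q - k))) ≤
    2 * ∑ i ∈ range p, ∑ j ∈ range q, mismatchInc w w' U (a + i) (c + j) := by
  set h := balance w with hh
  set h' := balance w' with hh'
  have hIe : h (a + p) = h a := hI.eq
  have hJe : h' (c + q) = h' c := neg_injective hJ.eq
  have hJ' : ∀ r, c ≤ r → r ≤ c + q → h' r ≤ h' c := fun r h1 h2 => neg_le_neg_iff.1 (hJ.ge r h1 h2)
  have one : ∀ t, 2 * letterCount w true t = t + h t := two_mul_letterCount_true w
  have zero : ∀ t, 2 * letterCount w false t = t - h t := two_mul_letterCount_false w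
  have one' : ∀ t, 2 * letterCount w' true t = t + h' t := two_mul_letterCount_true w'
  have zero' : ∀ t, 2 * letterCount w' false t = t - h' t := two_mul_letterCount_false w'
  have cells : 2 * ∑ i ∈ range p, ∑ j ∈ range q,
      (U (a + (i + 1)) (c + (j + 1)) - U (a + i) (c + j)) ≤
      2 * ∑ i ∈ range p, ∑ j ∈ range q, mismatchInc w w' U (a + i) (c + j) + p * q := by
    -- The summand is 2 on matched cells and 0 on the others. Since the walk of `w` returns to its
    -- starting value, exactly half of the cells are matched, and `step` bounds the increment of
    -- each by 1.
    have e : (p * q : ℤ) = ∑ i ∈ range p, ∑ j ∈ range q,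
        (1 + (h (a + (i + 1)) - h (a + i)) * (h' (c + (j + 1)) - h' (c + j))) := by
      simp only [sum_add_distrib, sum_const, card_range, nsmul_eq_mul, mul_one, ← mul_sum]
      rw [sum_range_sub (fun j => h' (c + j)), ← sum_mul, sum_range_sub (fun i => h (a + i))]
      simp [hIe]
    rw [e, mul_sum, mul_sum, ← sum_add_distrib]
    refine sum_le_sum fun i _ => ?_
    rw [mul_sum, mul_sum, ← sum_add_distrib]
    refine sum_le_sum fun j _ => ?_
    simp only [← add_assoc]
    rw [hh, hh', balance_succ, balance_succ]
    have hs := hU.step (a + i) (c + j)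
    unfold mismatchInc
    cases hw : w (a + i) <;> cases hw' : w' (c + j) <;> simp <;> linarith
  have B1 : ∀ k ∈ range p, (k : ℤ) + min (h (a + p - k) - h a) (h' c - h' (c + k)) ≤
      2 * (U (a + p) (c + k) - U (a + (p - k)) (c + 0)) := by
    intro k hk
    rw [mem_range] at hk
    have := hU.add_min_letterCount_le false (t := a + (p - k)) (t' := a + p) (r := c) (r' := c + k)
      (by omega) (by omega)
    have z1 := zero (a + p)
    have z2 := zero (a + (p - k))
    have z3 := zero' (c + k)
    have z4 := zero' c
    rw [show a + p - k = a + (p - k) by omega]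
    rw [Nat.cast_add, Nat.cast_sub hk.le] at z2
    push_cast at z1 z3
    simp only [add_zero]
    omega
  have B2 : ∀ k ∈ range p, ((k : ℤ) + 1) + min (h (a + (k + 1)) - h a) (h' c - h' (c + q - (k + 1)))
      ≤ 2 * (U (a + (k + 1)) (c + q) - U (a + 0) (c + (q - (k + 1)))) := by
    intro k hk
    rw [mem_range] at hk
    have := hU.add_min_letterCount_le true (t := a) (t' := a + (k + 1)) (r := c + (q - (k + 1)))
      (r' := c + q) (by omega) (by omega)
    have z1 := one (a + (k + 1))
    have z2 := one a
    have z3 := one' (c + q)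
    have z4 := one' (c + (q - (k + 1)))
    rw [show c + q - (k + 1) = c + (q - (k + 1)) by omega]
    rw [Nat.cast_add, Nat.cast_sub (by omega)] at z4
    push_cast at z1 z3 z4
    simp only [add_zero]
    omega
  -- A full diagonal grows by at least `p / 2`: the excursion of `w` has `p / 2` copies of each
  -- letter, and some letter occurs at least `p / 2` times among the `p` letters of `w'`.
  have B3 : ∀ j ∈ range (q - p), (p : ℤ) ≤ 2 * (U (a + p) (c + (p + j)) - U (a + 0) (c + j)) := by
    intro j hj
    rw [mem_range] at hj
    have u1 := hU.add_min_letterCount_le true (t := a) (t' := a + p) (r := c + j)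
      (r' := c + (p + j)) (by omega) (by omega)
    have u2 := hU.add_min_letterCount_le false (t := a) (t' := a + p) (r := c + j)
      (r' := c + (p + j)) (by omega) (by omega)
    have z1 := one (a + p)
    have z2 := one a
    have z3 := one' (c + j)
    have z4 := one' (c + (p + j))
    have y1 := zero (a + p)
    have y2 := zero a
    have y3 := zero' (c + j)
    have y4 := zero' (c + (p + j))
    push_cast at z1 z3 z4 y1 y3 y4
    simp only [add_zero]
    omega
  have total := sum_diagonal_increments (fun i j => U (a + i) (c + j)) hpq
  have s1 := sum_le_sum B1
  have s2 := sum_le_sum B2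
  have s3 := sum_le_sum B3
  rw [← mul_sum, sum_add_distrib] at s1 s2
  rw [← mul_sum, sum_const, card_range, nsmul_eq_mul, Nat.cast_sub hpq] at s3
  -- Replacing `k + 1` by `k` drops the term at `p`, which is nonnegative, and adds the term at 0,
  -- which vanishes.
  have shift : ∑ k ∈ range p, min (h (a + k) - h a) (h' c - h' (c + q - k)) ≤
      ∑ k ∈ range p, min (h (a + (k + 1)) - h a) (h' c - h' (c + q - (k + 1))) := by
    have t1 := sum_range_succ (fun k => min (h (a + k) - h a) (h' c - h' (c + q - k))) p
    have t2 := sum_range_succ' (fun k => min (h (a + k) - h a) (h' c - h' (c + q - k))) p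
    have t3 : 0 ≤ min (h (a + p) - h a) (h' c - h' (c + q - p)) := by
      have := hJ' (c + q - p) (by omega) (by omega)
      rw [hIe]
      simp only [sub_self]
      exact le_min le_rfl (by linarith)
    have t4 : min (h (a + 0) - h a) (h' c - h' (c + q - 0)) = 0 := by
      simp [hJe]
    linarith
  have gauss : 2 * ∑ k ∈ range p, (k : ℤ) = p * p - p := by
    clear * -
    induction p with
    | zero => simp
    | succ p ih => rw [sum_range_succ, mul_add, ih]; push_cast; ring
  have gauss' : ∑ k ∈ range p, ((k : ℤ) + 1) = ∑ k ∈ range p, (k : ℤ) + p := by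
    rw [sum_add_distrib]; simp
  rw [sum_add_distrib]
  have expand : ((q : ℤ) - p) * p = p * q - p * p := by ring
  linarith

/-- A positive excursion of `w` against a negative excursion of `w'`. -/
theorem rectangle (hU : IsProfile w w' U) {a c p q : ℕ}
    (hI : IsExcursion (balance w) a (a + p)) (hJ : IsExcursion (fun r => -balance w' r) c (c + q)) :
    ∑ k ∈ range (min p q),
      (min (balance w (a + p - k) - balance w a) (balance w' c - balance w' (c + k))
      + min (balance w (a + k) - balance w a) (balance w' c - balance w' (c + q - k))) ≤
    2 * ∑ i ∈ range p, ∑ j ∈ range q, mismatchInc w w' U (a + i) (c + j) := by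
  rcases le_total p q with hpq | hpq
  · rw [min_eq_left hpq]
    exact hU.rectangle_aux hpq hI hJ
  · rw [min_eq_right hpq]
    have hI' : IsExcursion (balance fun s => !w' s) c (c + q) := by
      rwa [show (balance fun s => !w' s) = fun r => -balance w' r from funext (balance_flip w')]
    have hJ' : IsExcursion (fun r => -balance (fun s => !w s) r) a (a + p) := by
      simpa only [balance_flip, neg_neg] using hI
    -- Exchanging the words turns the negative excursion into the first one; exchanging the letters
    -- makes it positive again.
    have := hU.transpose.flip.rectangle_aux hpq hI' hJ'
    rw [sum_comm]
    refine le_trans (sum_le_sum fun k _ => ?_) (this.trans (le_of_eq ?_))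
    · simp only [balance_flip]
      rw [add_comm, min_comm (balance w (a + k) - balance w a), min_comm (balance w (a + p - k) - _)]
      refine le_of_eq ?_
      congr 2 <;> ring
    · congr 1
      refine sum_congr rfl fun j _ => sum_congr rfl fun i _ => ?_
      unfold mismatchInc
      cases hw : w (a + i) <;> cases hw' : w' (c + j) <;> simp [hw, hw']

end IsProfile

/-! ### Steep excursions below a peak -/

theorem exists_last_eq {h : ℕ → ℤ} (hstep : ∀ t, |h (t + 1) - h t| ≤ 1) {d u : ℕ} (hdu : d ≤ u)
    {v : ℤ} (hd : h d ≤ v) (hu : v ≤ h u) :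
    ∃ a, d ≤ a ∧ a ≤ u ∧ h a = v ∧ ∀ t, a < t → t ≤ u → v < h t := by
  induction u, hdu using Nat.le_induction with
  | base => exact ⟨d, le_rfl, le_rfl, le_antisymm hd hu, fun t h1 h2 => by omega⟩
  | succ u hdu ih =>
    rcases hu.eq_or_lt with hu | hu
    · exact ⟨u + 1, by omega, le_rfl, hu.symm, fun t h1 h2 => by omega⟩
    · have := abs_le.1 (hstep u)
      obtain ⟨a, h1, h2, h3, h4⟩ := ih (by omega)
      refine ⟨a, h1, by omega, h3, fun t ht1 ht2 => ?_⟩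
      rcases Nat.lt_or_ge t (u + 1) with h5 | h5
      · exact h4 t ht1 (by omega)
      · rwa [show t = u + 1 by omega]

theorem exists_first_eq {h : ℕ → ℤ} (hstep : ∀ t, |h (t + 1) - h t| ≤ 1) {u e : ℕ} (hue : u ≤ e)
    {v : ℤ} (he : h e ≤ v) (hu : v ≤ h u) :
    ∃ b, u ≤ b ∧ b ≤ e ∧ h b = v ∧ ∀ t, u ≤ t → t < b → v < h t := by
  have hex : ∃ t, u ≤ t ∧ h t ≤ v := ⟨e, hue, he⟩
  classical
  obtain ⟨h1, h2⟩ := Nat.find_spec hex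
  have hmin : ∀ t, u ≤ t → t < Nat.find hex → v < h t := fun t ht hlt => by
    by_contra hcon
    exact Nat.find_min hex hlt ⟨ht, not_lt.1 hcon⟩
  refine ⟨Nat.find hex, h1, Nat.find_min' hex ⟨hue, he⟩, le_antisymm h2 ?_, hmin⟩
  rcases h1.eq_or_lt with h3 | h3
  · rw [← h3]; exact hu
  · obtain ⟨b, hb⟩ := Nat.exists_eq_succ_of_ne_zero (show Nat.find hex ≠ 0 by omega)
    have := hmin b (by omega) (by omega)
    have := abs_le.1 (hstep b)
    rw [hb, Nat.succ_eq_add_one]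
    omega

/-- A peak of height `l` inside an interval of length `D` contains an excursion whose two flanks
both have slope at least `l / (2 * D)`. -/
theorem exists_steep_excursion {h : ℕ → ℤ} (hstep : ∀ t, |h (t + 1) - h t| ≤ 1) {d u e l : ℕ}
    (hdu : d ≤ u) (hue : u ≤ e) (hl : 1 ≤ l) (hd : h d + l ≤ h u) (he : h e + l ≤ h u) :
    ∃ a b μ : ℕ, d ≤ a ∧ b ≤ e ∧ IsExcursion h a b ∧ l ≤ 2 * μ ∧ a + 2 * μ ≤ b ∧
      ∀ q ≤ μ, (l : ℤ) * q ≤ 2 * ((e : ℤ) - d) * (h (a + q) - h a) ∧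
        (l : ℤ) * q ≤ 2 * ((e : ℤ) - d) * (h (b - q) - h a) := by
  have lip : ∀ s t : ℕ, h (s + t) ≤ h s + t ∧ h s ≤ h (s + t) + t := by
    intro s t
    induction t with
    | zero => simp
    | succ t ih =>
      have := abs_le.1 (hstep (s + t))
      rw [← add_assoc]
      push_cast
      constructor <;> linarith
  have hA : ∀ μ : ℕ, μ ≤ l → ∃ a, d ≤ a ∧ a ≤ u ∧ h a = h u - μ ∧
      ∀ t, a < t → t ≤ u → h u - μ < h t := fun μ hμ =>
    exists_last_eq hstep hdu (by omega) (by omega)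
  have hB : ∀ μ : ℕ, μ ≤ l → ∃ b, u ≤ b ∧ b ≤ e ∧ h b = h u - μ ∧
      ∀ t, u ≤ t → t < b → h u - μ < h t := fun μ hμ =>
    exists_first_eq hstep hue (by omega) (by omega)
  choose! A hA1 hA2 hA3 hA4 using hA
  choose! B hB1 hB2 hB3 hB4 using hB
  have hD2 : (2 * l : ℤ) ≤ e - d := by
    have h1 := (lip d (u - d)).1
    have h2 := (lip u (e - u)).2
    rw [Nat.add_sub_cancel' hdu] at h1
    rw [Nat.add_sub_cancel' hue] at h2
    omega
  set D : ℤ := (e : ℤ) - d with hD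
  -- `[A μ, B μ]` is the excursion around `u` at depth `μ` below the peak. The depth minimises width
  -- minus a multiple of depth: comparison with depth `l` forces `l ≤ 2 * μ`, and comparison with
  -- smaller depths shows that neither flank is flatter than slope `l / (2 * D)`.
  obtain ⟨μ, hμ, hmin⟩ := exists_min_image (range (l + 1))
    (fun μ => (l : ℤ) * ((B μ : ℤ) - A μ) - 2 * D * μ) ⟨0, by simp⟩
  have hμl : μ ≤ l := by simpa [Nat.lt_succ_iff] using hμ
  have hlen : u ≤ B μ - μ ∧ μ ≤ B μ ∧ A μ + μ ≤ u := by
    have h1 := (lip (A μ) (u - A μ)).1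
    have h2 := (lip u (B μ - u)).2
    rw [Nat.add_sub_cancel' (hA2 μ hμl), hA3 μ hμl] at h1
    rw [Nat.add_sub_cancel' (hB1 μ hμl), hB3 μ hμl] at h2
    have := hA2 μ hμl
    have := hB1 μ hμl
    omega
  have hexc : IsExcursion h (A μ) (B μ) := by
    refine ⟨by omega, by rw [hB3 μ hμl, hA3 μ hμl], fun t h1 h2 => ?_⟩
    rw [hA3 μ hμl]
    rcases le_total t u with htu | htu
    · rcases h1.eq_or_lt with h3 | h3
      · rw [← h3, hA3 μ hμl]
      · exact (hA4 μ hμl t h3 htu).le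
    · rcases h2.eq_or_lt with h3 | h3
      · rw [h3, hB3 μ hμl]
      · exact (hB4 μ hμl t htu h3).le
  have hl0 : (1 : ℤ) ≤ l := by exact_mod_cast hl
  have hhalf : l ≤ 2 * μ := by
    have h1 := hmin l (by simp)
    have h2 : ((B l : ℤ) - A l) ≤ D := by
      have := hA1 l le_rfl
      have := hB2 l le_rfl
      omega
    have h3 : (0 : ℤ) ≤ (B μ : ℤ) - A μ := by omega
    have h4 := mul_le_mul_of_nonneg_left h2 (by linarith : (0 : ℤ) ≤ l)
    have h5 := mul_nonneg (by linarith : (0 : ℤ) ≤ l) h3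
    have h6 : D * l ≤ D * (2 * μ) := by linarith
    have := le_of_mul_le_mul_left h6 (by linarith)
    exact_mod_cast this
  -- If the walk has risen only `x` after `q` steps from one end, the excursion at depth `μ - x` is
  -- narrower by at least `q`; minimality then bounds `q` by a multiple of `x`. For `x` beyond `μ`
  -- the bound is immediate from `q ≤ μ`.
  have flank : ∀ (q : ℕ) (x : ℤ), q ≤ μ → 0 ≤ x →
      (x ≤ μ → (q : ℤ) ≤ ((B μ : ℤ) - A μ) - ((B (μ - x.toNat) : ℤ) - A (μ - x.toNat))) →
      (l : ℤ) * q ≤ 2 * D * x := by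
    intro q x hq hx hxq
    rcases le_total x μ with h1 | h1
    · have h2 := hmin (μ - x.toNat) (by rw [mem_range]; omega)
      have h3 := mul_le_mul_of_nonneg_left (hxq h1) (by linarith : (0 : ℤ) ≤ l)
      rw [show ((μ - x.toNat : ℕ) : ℤ) = μ - x by omega] at h2
      linarith
    · have h2 : (q : ℤ) ≤ x := le_trans (by exact_mod_cast hq) h1
      calc (l : ℤ) * q ≤ l * x := mul_le_mul_of_nonneg_left h2 (by linarith)
        _ ≤ 2 * D * x := mul_le_mul_of_nonneg_right (by linarith) hx
  refine ⟨A μ, B μ, μ, hA1 μ hμl, hB2 μ hμl, hexc, hhalf, by omega, fun q hq => ⟨?_, ?_⟩⟩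
  · have hx := hexc.ge (A μ + q) (by omega) (by omega)
    refine flank q _ hq (by linarith) fun hxμ => ?_
    set x := h (A μ + q) - h (A μ) with hxdef
    have hv : ((μ - x.toNat : ℕ) : ℤ) = μ - x := by omega
    have hvl : μ - x.toNat ≤ l := by omega
    have h1 : A μ + q ≤ A (μ - x.toNat) := by
      by_contra hcon
      have := hA4 _ hvl (A μ + q) (by omega) (by omega)
      have := hA3 μ hμl
      omega
    have h2 : B (μ - x.toNat) ≤ B μ := by
      by_contra hcon
      have := hB4 _ hvl (B μ) (hB1 μ hμl) (by omega)
      have := hB3 μ hμl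
      omega
    omega
  · have hx := hexc.ge (B μ - q) (by omega) (by omega)
    refine flank q _ hq (by linarith) fun hxμ => ?_
    set x := h (B μ - q) - h (A μ) with hxdef
    have hv : ((μ - x.toNat : ℕ) : ℤ) = μ - x := by omega
    have hvl : μ - x.toNat ≤ l := by omega
    have h1 : B (μ - x.toNat) ≤ B μ - q := by
      by_contra hcon
      have := hB4 _ hvl (B μ - q) (by omega) (by omega)
      have := hA3 μ hμl
      omega
    have h2 : A μ ≤ A (μ - x.toNat) := by
      by_contra hcon
      have := hA4 _ hvl (A μ) (by omega) (hA2 μ hμl)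
      have := hA3 μ hμl
      omega
    omega

theorem abs_balance_succ_sub (w : ℕ → Bool) (t : ℕ) : |balance w (t + 1) - balance w t| ≤ 1 := by
  rw [balance_succ]
  split_ifs <;> simp

/-- A peak of `w` against a valley of `w'`. -/
theorem IsProfile.peak_valley_gain {w w' : ℕ → Bool} {U : ℕ → ℕ → ℤ} (hU : IsProfile w w' U)
    {d u e l d' u' e' l' : ℕ} (hdu : d ≤ u) (hue : u ≤ e) (hl : 1 ≤ l)
    (hd : balance w d + l ≤ balance w u) (he : balance w e + l ≤ balance w u)
    (hdu' : d' ≤ u') (hue' : u' ≤ e') (hl' : 1 ≤ l')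
    (hd' : -balance w' d' + l' ≤ -balance w' u') (he' : -balance w' e' + l' ≤ -balance w' u') :
    (min l l' : ℝ) ^ 2 / 8 * min ((l : ℝ) / (2 * ((e : ℝ) - d))) ((l' : ℝ) / (2 * ((e' : ℝ) - d')))
      ≤ ((∑ t ∈ Ico d e, ∑ r ∈ Ico d' e', mismatchInc w w' U t r : ℤ) : ℝ) := by
  obtain ⟨a, b, μ, hda, hbe, hexc, hμ, hab, hflank⟩ :=
    exists_steep_excursion (abs_balance_succ_sub w) hdu hue hl hd he
  obtain ⟨a', b', μ', hda', hbe', hexc', hμ', hab', hflank'⟩ :=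
    exists_steep_excursion (h := fun r => -balance w' r)
      (fun t => by rw [neg_sub_neg, abs_sub_comm]; exact abs_balance_succ_sub w' t)
      hdu' hue' hl' hd' he'
  set ρ := min ((l : ℝ) / (2 * ((e : ℝ) - d))) ((l' : ℝ) / (2 * ((e' : ℝ) - d'))) with hρ
  have hD : (0 : ℝ) < 2 * ((e : ℝ) - d) := by
    have : d < e := by omega
    have : (d : ℝ) < e := by exact_mod_cast this
    linarith
  have hD' : (0 : ℝ) < 2 * ((e' : ℝ) - d') := by
    have : d' < e' := by omega
    have : (d' : ℝ) < e' := by exact_mod_cast this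
    linarith
  have hρ0 : 0 ≤ ρ := le_min (by positivity) (by positivity)
  obtain ⟨p, rfl⟩ := Nat.exists_eq_add_of_le hexc.le
  obtain ⟨q, rfl⟩ := Nat.exists_eq_add_of_le hexc'.le
  have rect := hU.rectangle hexc hexc'
  have slope : ∀ k ≤ μ, ρ * k ≤ ((balance w (a + k) - balance w a : ℤ) : ℝ) ∧
      ρ * k ≤ ((balance w (a + p - k) - balance w a : ℤ) : ℝ) := by
    intro k hk
    obtain ⟨h1, h2⟩ := hflank k hk
    have h1' : (l : ℝ) * k ≤ 2 * ((e : ℝ) - d) * ((balance w (a + k) - balance w a : ℤ) : ℝ) := by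
      exact_mod_cast h1
    have h2' : (l : ℝ) * k ≤ 2 * ((e : ℝ) - d) * ((balance w (a + p - k) - balance w a : ℤ) : ℝ) := by
      exact_mod_cast h2
    have h3 : ρ * k ≤ (l : ℝ) / (2 * ((e : ℝ) - d)) * k :=
      mul_le_mul_of_nonneg_right (min_le_left _ _) (Nat.cast_nonneg k)
    rw [div_mul_eq_mul_div] at h3
    exact ⟨h3.trans ((div_le_iff₀' hD).2 h1'), h3.trans ((div_le_iff₀' hD).2 h2')⟩
  have slope' : ∀ k ≤ μ', ρ * k ≤ ((balance w' a' - balance w' (a' + k) : ℤ) : ℝ) ∧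
      ρ * k ≤ ((balance w' a' - balance w' (a' + q - k) : ℤ) : ℝ) := by
    intro k hk
    obtain ⟨h1, h2⟩ := hflank' k hk
    rw [neg_sub_neg] at h1 h2
    have h1' : (l' : ℝ) * k ≤
        2 * ((e' : ℝ) - d') * ((balance w' a' - balance w' (a' + k) : ℤ) : ℝ) := by
      exact_mod_cast h1
    have h2' : (l' : ℝ) * k ≤
        2 * ((e' : ℝ) - d') * ((balance w' a' - balance w' (a' + q - k) : ℤ) : ℝ) := by
      exact_mod_cast h2
    have h3 : ρ * k ≤ (l' : ℝ) / (2 * ((e' : ℝ) - d')) * k :=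
      mul_le_mul_of_nonneg_right (min_le_right _ _) (Nat.cast_nonneg k)
    rw [div_mul_eq_mul_div] at h3
    exact ⟨h3.trans ((div_le_iff₀' hD').2 h1'), h3.trans ((div_le_iff₀' hD').2 h2')⟩
  -- Both pairs of flanks have slope at least `ρ` over their first `ν` steps, so the sum of
  -- `rectangle` is at least `ρ * ν ^ 2`. The 8 in the bound is the 2 of `rectangle` times 4 from
  -- `min l l' ≤ 2 * ν`.
  set ν := min μ μ' with hν
  have lower : ρ * ν ^ 2 ≤ ((∑ k ∈ range (min p q),
      (min (balance w (a + p - k) - balance w a) (balance w' a' - balance w' (a' + k))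
      + min (balance w (a + k) - balance w a) (balance w' a' - balance w' (a' + q - k))) : ℤ) : ℝ) := by
    have gauss : 2 * ∑ k ∈ range (ν + 1), (k : ℝ) = ν ^ 2 + ν := by
      clear * -
      induction ν with
      | zero => simp
      | succ p ih => rw [sum_range_succ, mul_add, ih]; push_cast; ring
    calc ρ * ν ^ 2 ≤ ρ * (ν ^ 2 + ν) :=
          mul_le_mul_of_nonneg_left (by linarith [Nat.cast_nonneg (α := ℝ) ν]) hρ0
      _ = ∑ k ∈ range (ν + 1), (2 * (ρ * k)) := by
          rw [← gauss, ← mul_sum, ← mul_sum]; ring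
      _ ≤ ((∑ k ∈ range (ν + 1),
      (min (balance w (a + p - k) - balance w a) (balance w' a' - balance w' (a' + k))
      + min (balance w (a + k) - balance w a) (balance w' a' - balance w' (a' + q - k))) : ℤ) : ℝ) := by
          push_cast
          refine sum_le_sum fun k hk => ?_
          rw [mem_range] at hk
          have s1 := slope k (by omega)
          have s2 := slope' k (by omega)
          push_cast at s1 s2
          have := le_min s1.2 s2.1
          have := le_min s1.1 s2.2
          linarith
      _ ≤ _ := by
          rw [Int.cast_le]
          refine sum_le_sum_of_subset_of_nonneg ?_ ?_
          · intro k hk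
            rw [mem_range] at hk ⊢
            omega
          · intro k hk _
            rw [mem_range] at hk
            have g1 := hexc.ge (a + k) (by omega) (by omega)
            have g2 := hexc.ge (a + p - k) (by omega) (by omega)
            have g3 := neg_le_neg_iff.1 (hexc'.ge (a' + k) (by omega) (by omega))
            have g4 := neg_le_neg_iff.1 (hexc'.ge (a' + q - k) (by omega) (by omega))
            exact add_nonneg (le_min (by linarith) (by linarith)) (le_min (by linarith) (by linarith))
  have embed : ∑ i ∈ range p, ∑ j ∈ range q, mismatchInc w w' U (a + i) (a' + j) ≤
      ∑ t ∈ Ico d e, ∑ r ∈ Ico d' e', mismatchInc w w' U t r := by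
    have e1 : ∑ i ∈ range p, ∑ j ∈ range q, mismatchInc w w' U (a + i) (a' + j) =
        ∑ t ∈ Ico a (a + p), ∑ r ∈ Ico a' (a' + q), mismatchInc w w' U t r := by
      rw [sum_Ico_eq_sum_range, Nat.add_sub_cancel_left]
      refine sum_congr rfl fun i _ => ?_
      rw [sum_Ico_eq_sum_range, Nat.add_sub_cancel_left]
    rw [e1]
    refine (sum_le_sum fun t _ => sum_le_sum_of_subset_of_nonneg (Ico_subset_Ico hda' hbe')
      fun r _ _ => hU.mismatchInc_nonneg t r).trans ?_
    exact sum_le_sum_of_subset_of_nonneg (Ico_subset_Ico hda hbe)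
      fun t _ _ => sum_nonneg fun r _ => hU.mismatchInc_nonneg t r
  have rect' := Int.cast_le (R := ℝ) |>.2 rect
  have embed' := Int.cast_le (R := ℝ) |>.2 embed
  rw [Int.cast_mul, Int.cast_ofNat] at rect'
  have hνl : (min l l' : ℝ) ≤ 2 * ν := by
    have : min l l' ≤ 2 * ν := by omega
    exact_mod_cast this
  have hsq : (min l l' : ℝ) ^ 2 ≤ (2 * ν) ^ 2 :=
    pow_le_pow_left₀ (by positivity) hνl 2
  have := mul_le_mul_of_nonneg_left hsq hρ0
  linarith

/-! ### Charged variation and peaks at dyadic scales -/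

/-- Twice the variation of `g` along a list of times, with every step charged `κ`. -/
def chargedVariation (g : ℕ → ℤ) (κ : ℤ) : List ℕ → ℤ
  | [] => 0
  | [_] => 0
  | x :: y :: T => (2 * |g y - g x| - κ) + chargedVariation g κ (y :: T)

theorem chargedVariation_append (g : ℕ → ℤ) (κ : ℤ) (L : List ℕ) (x : ℕ) (M : List ℕ) :
    chargedVariation g κ (L ++ x :: M) =
      chargedVariation g κ (L ++ [x]) + chargedVariation g κ (x :: M) := by
  induction L with
  | nil => simp [chargedVariation]
  | cons a L ih =>
    cases L with
    | nil => simp [chargedVariation]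
    | cons b L =>
      simp only [List.cons_append, chargedVariation] at ih ⊢
      rw [ih]
      ring

theorem chargedVariation_add (g : ℕ → ℤ) (κ κ' : ℤ) (T : List ℕ) :
    chargedVariation g (κ + κ') T = chargedVariation g κ T - κ' * (T.length - 1 : ℕ) := by
  induction T with
  | nil => simp [chargedVariation]
  | cons x T ih =>
    cases T with
    | nil => simp [chargedVariation]
    | cons y T =>
      simp only [chargedVariation, List.length_cons, Nat.add_sub_cancel] at ih ⊢
      rw [ih]
      push_cast
      ring

/-- With charge 1 a unit step is worth `2 - 1 = 1`, so a list that skips the flat steps recovers the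
full variation. -/
theorem exists_chargedVariation_eq (g : ℕ → ℤ) (hg : ∀ t, |g (t + 1) - g t| ≤ 1) (s W : ℕ) :
    ∃ T : List ℕ, T.Sublist (List.range' s (W + 1)) ∧
      chargedVariation g 1 T = ∑ t ∈ range W, |g (s + t + 1) - g (s + t)| := by
  suffices H : ∃ (x : ℕ) (T : List ℕ), (x :: T).Sublist (List.range' s (W + 1)) ∧ g x = g s ∧
      chargedVariation g 1 (x :: T) = ∑ t ∈ range W, |g (s + t + 1) - g (s + t)| by
    obtain ⟨x, T, h1, -, h2⟩ := H
    exact ⟨_, h1, h2⟩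
  induction W generalizing s with
  | zero => exact ⟨s, [], by simp, rfl, by simp [chargedVariation]⟩
  | succ W ih =>
    obtain ⟨x, T, h1, h2, h3⟩ := ih (s + 1)
    rw [sum_range_succ', show List.range' s (W + 1 + 1) = s :: List.range' (s + 1) (W + 1) from rfl]
    have e : ∑ t ∈ range W, |g (s + (t + 1) + 1) - g (s + (t + 1))| =
        ∑ t ∈ range W, |g (s + 1 + t + 1) - g (s + 1 + t)| :=
      sum_congr rfl fun t _ => by rw [show s + (t + 1) = s + 1 + t by ring]
    rw [e, ← h3]
    by_cases hs : g (s + 1) = g s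
    · exact ⟨x, T, h1.trans (List.sublist_cons_self _ _), h2.trans hs, by simp [hs]⟩
    · refine ⟨s, x :: T, h1.cons_cons s, rfl, ?_⟩
      have : |g (s + 1) - g s| = 1 := by
        have := hg s
        have : 0 < |g (s + 1) - g s| := abs_pos.2 (sub_ne_zero.2 hs)
        linarith
      simp only [chargedVariation, h2, add_zero, this]
      ring

/-- A list of times, maximal for the variation with charge `2 * l - 1`. -/
structure IsOptimal (g : ℕ → ℤ) (l s W : ℕ) (T : List ℕ) : Prop where
  sub : T.Sublist (List.range' s (W + 1))
  max : ∀ T' : List ℕ, T'.Sublist (List.range' s (W + 1)) →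
    chargedVariation g (2 * l - 1) T' ≤ chargedVariation g (2 * l - 1) T

theorem exists_isOptimal (g : ℕ → ℤ) (l s W : ℕ) : ∃ T, IsOptimal g l s W T := by
  obtain ⟨T, hT, hmax⟩ := exists_max_image (List.range' s (W + 1)).sublists.toFinset
    (chargedVariation g (2 * l - 1)) ⟨[], by simp⟩
  simp only [List.mem_toFinset, List.mem_sublists] at hT hmax
  exact ⟨T, hT, hmax⟩

namespace IsOptimal

variable {g : ℕ → ℤ} {l s W : ℕ} {T : List ℕ}

/-- Otherwise `g y` lies weakly between `g x` and `g z`, and deleting `y` loses no variation but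
saves a charge. -/
theorem alternating (hT : IsOptimal g l s W T) (hl : 1 ≤ l) {L M : List ℕ} {x y z : ℕ}
    (h : T = L ++ x :: y :: z :: M) :
    (g x < g y ∧ g z < g y) ∨ (g y < g x ∧ g y < g z) := by
  have hl' : (1 : ℤ) ≤ l := by exact_mod_cast hl
  have sub : (L ++ x :: z :: M).Sublist T := by
    rw [h]
    exact (List.Sublist.refl L).append ((List.sublist_cons_self y _).cons_cons x)
  have := hT.max _ (sub.trans hT.sub)
  rw [h, chargedVariation_append, chargedVariation_append g _ L x (y :: z :: M)] at this
  simp only [chargedVariation] at this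
  by_contra hcon
  have : |g z - g x| = |g y - g x| + |g z - g y| := by
    rcases le_total (g x) (g y) with h1 | h1
    · rcases le_total (g y) (g z) with h2 | h2
      · rw [abs_of_nonneg (by linarith), abs_of_nonneg (by linarith), abs_of_nonneg (by linarith)]
        ring
      · rcases h1.eq_or_lt with h3 | h3
        · simp [h3]
        · rcases h2.eq_or_lt with h4 | h4
          · simp [h4]
          · exact absurd (Or.inl ⟨h3, h4⟩) hcon
    · rcases le_total (g z) (g y) with h2 | h2
      · rw [abs_of_nonpos (by linarith), abs_of_nonpos (by linarith), abs_of_nonpos (by linarith)]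
        ring
      · rcases h1.eq_or_lt with h3 | h3
        · simp [h3]
        · rcases h2.eq_or_lt with h4 | h4
          · simp [h4]
          · exact absurd (Or.inr ⟨h3, h4⟩) hcon
  linarith

/-- A step shorter than `l` could be removed with profit. At either end of the list, deleting the
extreme point loses at most `2 * l - 2` and saves a charge `2 * l - 1`. In the interior, deleting
both points loses by alternation at most `4 * (l - 1)` and saves two charges. -/
theorem le_step (hT : IsOptimal g l s W T) (hl : 1 ≤ l) {L M : List ℕ} {x y : ℕ}
    (h : T = L ++ x :: y :: M) : (l : ℤ) ≤ |g y - g x| := by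
  have hl' : (1 : ℤ) ≤ l := by exact_mod_cast hl
  by_contra! hcon
  rcases List.eq_nil_or_concat L with rfl | ⟨L, a, rfl⟩
  · have sub : (y :: M).Sublist T := by
      rw [h]
      exact List.sublist_cons_self x _
    have := hT.max _ (sub.trans hT.sub)
    rw [h] at this
    simp only [List.nil_append, chargedVariation] at this
    linarith
  · rw [List.concat_eq_append, List.append_assoc, List.singleton_append] at h
    cases M with
    | nil =>
      have sub : (L ++ a :: [x]).Sublist T := by
        rw [h]
        exact (List.Sublist.refl L).append
          (((List.nil_sublist [y]).cons_cons x).cons_cons a)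
      have := hT.max _ (sub.trans hT.sub)
      rw [h, chargedVariation_append, chargedVariation_append g _ L a (x :: [y])] at this
      simp only [chargedVariation] at this
      linarith
    | cons b M =>
      have sub : (L ++ a :: b :: M).Sublist T := by
        rw [h]
        exact (List.Sublist.refl L).append
          (((List.sublist_cons_self y _).trans (List.sublist_cons_self x _)).cons_cons a)
      have := hT.max _ (sub.trans hT.sub)
      rw [h, chargedVariation_append, chargedVariation_append g _ L a (x :: y :: b :: M)] at this
      simp only [chargedVariation] at this
      have a1 := hT.alternating hl h
      have a2 := hT.alternating hl (L := L ++ [a]) (x := x) (y := y) (z := b) (M := M)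
        (by rw [h]; simp)
      rcases a1 with ⟨h1, h2⟩ | ⟨h1, h2⟩
      · rw [abs_of_pos (by linarith : 0 < g x - g a), abs_of_neg (by linarith : g y - g x < 0),
          abs_of_pos (by omega : 0 < g b - g y)] at this
        rw [abs_of_neg (by linarith : g y - g x < 0)] at hcon
        have := le_abs_self (g b - g a)
        linarith
      · rw [abs_of_neg (by linarith : g x - g a < 0), abs_of_pos (by linarith : 0 < g y - g x),
          abs_of_neg (by omega : g b - g y < 0)] at this
        rw [abs_of_pos (by linarith : 0 < g y - g x)] at hcon
        have := neg_le_abs (g b - g a)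
        linarith

end IsOptimal

/-- In the window `[s, s + W]` there are `P` consecutive intervals, in each of which `g` has a
point lying at least `l` above both ends of the interval. -/
def HasPeaks (g : ℕ → ℤ) (s W l P : ℕ) : Prop :=
  ∃ d : ℕ → ℕ, s ≤ d 0 ∧ d P ≤ s + W ∧
    ∀ k < P, ∃ u, d k ≤ u ∧ u ≤ d (k + 1) ∧ g (d k) + l ≤ g u ∧ g (d (k + 1)) + l ≤ g u

theorem hasPeaks_zero (g : ℕ → ℤ) (s W l : ℕ) : HasPeaks g s W l 0 :=
  ⟨fun _ => s, le_rfl, Nat.le_add_right _ _, fun _ hk => absurd hk (Nat.not_lt_zero _)⟩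

/-- The sequence `τ 0 < τ 1 < ... < τ n` is a zigzag starting upwards with steps at least `l`. -/
structure IsZigzag (g : ℕ → ℤ) (s W l n : ℕ) (τ : ℕ → ℕ) : Prop where
  ge : ∀ i ≤ n, s ≤ τ i
  le : ∀ i ≤ n, τ i ≤ s + W
  mono : ∀ i < n, τ i ≤ τ (i + 1)
  up : ∀ i, 2 * i + 1 ≤ n → g (τ (2 * i)) + l ≤ g (τ (2 * i + 1))
  down : ∀ i, 2 * i + 2 ≤ n → g (τ (2 * i + 2)) + l ≤ g (τ (2 * i + 1))

theorem IsZigzag.hasPeaks {g : ℕ → ℤ} {s W l n P : ℕ} {τ : ℕ → ℕ} (h : IsZigzag g s W l n τ)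
    (hP : 2 * P ≤ n) : HasPeaks g s W l P := by
  refine ⟨fun k => τ (2 * k), h.ge _ (by omega), h.le _ hP, fun k hk => ⟨τ (2 * k + 1),
    h.mono _ (by omega), h.mono _ (by omega), h.up k (by omega), h.down k (by omega)⟩⟩

theorem IsZigzag.hasPeaks_neg {g : ℕ → ℤ} {s W l n P : ℕ} {τ : ℕ → ℕ} (h : IsZigzag g s W l n τ)
    (hP : 2 * P + 1 ≤ n) : HasPeaks (fun t => -g t) s W l P := by
  refine ⟨fun k => τ (2 * k + 1), h.ge _ (by omega), h.le _ hP, fun k hk => ⟨τ (2 * k + 2),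
    h.mono _ (by omega), h.mono _ (by omega), ?_, ?_⟩⟩
  · linarith [h.down k (by omega)]
  · have := h.up (k + 1) (by omega)
    change -g (τ (2 * (k + 1) + 1)) + l ≤ -g (τ (2 * k + 2))
    rw [show 2 * (k + 1) = 2 * k + 2 by ring] at this ⊢
    linarith

theorem IsOptimal.exists_isZigzag {g : ℕ → ℤ} {l s W : ℕ} {T : List ℕ}
    (hT : IsOptimal g l s W T) (hl : 1 ≤ l) (hlen : 2 ≤ T.length) :
    ∃ τ, IsZigzag g s W l (T.length - 1) τ ∨ IsZigzag (fun t => -g t) s W l (T.length - 1) τ := by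
  have hmem : ∀ i (hi : i < T.length), s ≤ T[i] ∧ T[i] ≤ s + W := by
    intro i hi
    have := hT.sub.subset (List.getElem_mem hi)
    rw [List.mem_range'_1] at this
    omega
  have hpw : T.Pairwise (· < ·) := List.Pairwise.sublist hT.sub List.pairwise_lt_range'
  have hmono : ∀ i (hi : i + 1 < T.length), T[i] < T[i + 1] := fun i hi =>
    List.pairwise_iff_getElem.1 hpw i (i + 1) (by omega) hi (Nat.lt_succ_self i)
  have hstep : ∀ i (hi : i + 1 < T.length), (l : ℤ) ≤ |g T[i + 1] - g T[i]| := by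
    intro i hi
    refine hT.le_step hl (L := T.take i) (M := T.drop (i + 2)) ?_
    rw [← List.drop_eq_getElem_cons, ← List.drop_eq_getElem_cons, List.take_append_drop]
  have halt : ∀ i (hi : i + 2 < T.length),
      (g T[i] < g T[i + 1] ∧ g T[i + 2] < g T[i + 1]) ∨
        (g T[i + 1] < g T[i] ∧ g T[i + 1] < g T[i + 2]) := by
    intro i hi
    refine hT.alternating hl (L := T.take i) (M := T.drop (i + 3)) ?_
    rw [← List.drop_eq_getElem_cons, ← List.drop_eq_getElem_cons, ← List.drop_eq_getElem_cons,
      List.take_append_drop]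
  -- The default 0 is never read: a zigzag of `T.length - 1` steps only involves indices below
  -- `T.length`.
  set τ : ℕ → ℕ := fun i => T.getD i 0 with hτ
  have hτi : ∀ i (hi : i < T.length), τ i = T[i] := fun i hi => by
    simp [hτ, List.getD_eq_getElem?_getD, hi]
  have key : ∀ f : ℕ → ℤ, f (τ 0) < f (τ 1) →
      (∀ i (hi : i + 1 < T.length), (l : ℤ) ≤ |f T[i + 1] - f T[i]|) →
      (∀ i (hi : i + 2 < T.length), (f T[i] < f T[i + 1] ∧ f T[i + 2] < f T[i + 1]) ∨
        (f T[i + 1] < f T[i] ∧ f T[i + 1] < f T[i + 2])) →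
      IsZigzag f s W l (T.length - 1) τ := by
    intro f h0 hs ha
    have sgn : ∀ i, (2 * i + 1 < T.length → f (τ (2 * i)) < f (τ (2 * i + 1))) ∧
        (2 * i + 2 < T.length → f (τ (2 * i + 2)) < f (τ (2 * i + 1))) := by
      intro i
      have fst : ∀ i, (2 * i + 1 < T.length → f (τ (2 * i)) < f (τ (2 * i + 1))) →
          (2 * i + 2 < T.length → f (τ (2 * i + 2)) < f (τ (2 * i + 1))) := by
        intro i h1 h2
        have h3 := h1 (by omega)
        have h4 := ha (2 * i) h2
        rw [← hτi, ← hτi, ← hτi] at h4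
        rcases h4 with h4 | h4 <;> linarith [h4.1, h4.2]
      induction i with
      | zero => exact ⟨fun _ => h0, fst 0 fun _ => h0⟩
      | succ i ih =>
        have h1 : 2 * (i + 1) + 1 < T.length → f (τ (2 * (i + 1))) < f (τ (2 * (i + 1) + 1)) := by
          intro h2
          have h3 := ih.2 (by omega)
          have h4 := ha (2 * i + 1) (by omega)
          rw [← hτi, ← hτi, ← hτi] at h4
          rw [show 2 * (i + 1) = 2 * i + 2 by ring]
          rcases h4 with h4 | h4
          · exact absurd h4.1 (by simpa using h3.le)
          · exact h4.2
        exact ⟨h1, fst _ h1⟩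
    refine ⟨fun i hi => ?_, fun i hi => ?_, fun i hi => ?_, fun i hi => ?_, fun i hi => ?_⟩
    · rw [hτi i (by omega)]
      exact (hmem i (by omega)).1
    · rw [hτi i (by omega)]
      exact (hmem i (by omega)).2
    · rw [hτi i (by omega), hτi (i + 1) (by omega)]
      exact (hmono i (by omega)).le
    · have h1 := (sgn i).1 (by omega)
      have h2 := hs (2 * i) (by omega)
      rw [← hτi, ← hτi, abs_of_pos (by linarith)] at h2
      linarith
    · have h1 := (sgn i).2 (by omega)
      have h2 := hs (2 * i + 1) (by omega)
      rw [← hτi, ← hτi, abs_of_neg (by linarith)] at h2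
      linarith
  refine ⟨τ, ?_⟩
  have h01 : g (τ 0) ≠ g (τ 1) := by
    intro h
    have := hstep 0 (by omega)
    rw [← hτi, ← hτi, ← h] at this
    simp at this
    omega
  rcases lt_or_gt_of_ne h01 with h | h
  · exact Or.inl (key g h hstep halt)
  · refine Or.inr (key (fun t => -g t) (by simpa using h) (fun i hi => ?_) fun i hi => ?_)
    · rw [neg_sub_neg, abs_sub_comm]
      exact hstep i hi
    · simpa only [neg_lt_neg_iff, or_comm] using halt i hi

theorem IsOptimal.hasPeaks {g : ℕ → ℤ} {l s W P : ℕ} {T : List ℕ}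
    (hT : IsOptimal g l s W T) (hl : 1 ≤ l) (hP : 2 * P + 1 ≤ T.length - 1) :
    HasPeaks g s W l P ∧ HasPeaks (fun t => -g t) s W l P := by
  obtain ⟨τ, h | h⟩ := hT.exists_isZigzag hl (by omega)
  · exact ⟨h.hasPeaks (by omega), h.hasPeaks_neg hP⟩
  · exact ⟨by simpa using h.hasPeaks_neg hP, h.hasPeaks (by omega)⟩

/-- Multiscale decomposition of the variation of a bounded function. -/
theorem exists_hasPeaks_of_variation {g : ℕ → ℤ} (hg : ∀ t, |g (t + 1) - g t| ≤ 1) {G : ℤ}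
    (hG : ∀ t, |g t| ≤ G) (s W A : ℕ) (hA : 2 * G < 2 ^ A) :
    ∃ P : ℕ → ℕ, (∀ a, HasPeaks g s W (2 ^ a) (P a) ∧
        HasPeaks (fun t => -g t) s W (2 ^ a) (P a)) ∧
      ∑ t ∈ range W, |g (s + t + 1) - g (s + t)| ≤
        ∑ a ∈ range A, 2 ^ (a + 1) * (2 * (P a : ℤ) + 2) := by
  choose T hT using fun a : ℕ => exists_isOptimal g (2 ^ a) s W
  -- `2 * P + 1` alternating steps contain `P` peaks and also `P` valleys, whichever direction comes
  -- first.
  obtain ⟨P, hP⟩ : ∃ P : ℕ → ℕ, ∀ a, P a = ((T a).length - 1 - 1) / 2 := ⟨_, fun _ => rfl⟩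
  refine ⟨P, fun a => ?_, ?_⟩
  · by_cases h : 2 ≤ (T a).length
    · exact (hT a).hasPeaks Nat.one_le_two_pow (by rw [hP]; omega)
    · rw [show P a = 0 by rw [hP]; omega]
      exact ⟨hasPeaks_zero _ _ _ _, hasPeaks_zero _ _ _ _⟩
  · obtain ⟨T₀, h₀, hv⟩ := exists_chargedVariation_eq g hg s W
    rw [← hv]
    have first : chargedVariation g 1 T₀ ≤ chargedVariation g (2 * (2 ^ 0 : ℕ) - 1) (T 0) := by
      simpa using (hT 0).max T₀ h₀
    -- At scale `2 ^ A` no step is left, since the range of `g` has length at most `2 * G`.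
    have last : chargedVariation g (2 * (2 ^ A : ℕ) - 1) (T A) = 0 := by
      rcases hTA : T A with _ | ⟨x, _ | ⟨y, M⟩⟩
      · rfl
      · rfl
      · exfalso
        have := (hT A).le_step Nat.one_le_two_pow (L := []) hTA
        have h1 := abs_sub (g y) (g x)
        have h2 := hG y
        have h3 := hG x
        push_cast at this
        linarith
    -- Passing to the next scale raises the charge of every step of `T a` by `2 ^ (a + 1)`, and `T
    -- a` remains a competitor there.
    have hrec : ∀ a, chargedVariation g (2 * (2 ^ a : ℕ) - 1) (T a) ≤
        chargedVariation g (2 * (2 ^ (a + 1) : ℕ) - 1) (T (a + 1)) +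
          2 ^ (a + 1) * (2 * (P a : ℤ) + 2) := by
      intro a
      have h1 := (hT (a + 1)).max (T a) (hT a).sub
      have h2 := chargedVariation_add g (2 * (2 ^ a : ℕ) - 1) (2 ^ (a + 1)) (T a)
      rw [show (2 * (2 ^ a : ℕ) - 1 + 2 ^ (a + 1) : ℤ) = 2 * (2 ^ (a + 1) : ℕ) - 1 by
        push_cast; ring] at h2
      have h3 : (((T a).length - 1 : ℕ) : ℤ) ≤ 2 * (P a : ℤ) + 2 := by
        rw [hP]; omega
      have h4 := mul_le_mul_of_nonneg_left h3 (by positivity : (0 : ℤ) ≤ 2 ^ (a + 1))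
      linarith
    have tele : ∀ B, chargedVariation g (2 * (2 ^ 0 : ℕ) - 1) (T 0) ≤
        chargedVariation g (2 * (2 ^ B : ℕ) - 1) (T B) +
          ∑ a ∈ range B, 2 ^ (a + 1) * (2 * (P a : ℤ) + 2) := by
      intro B
      induction B with
      | zero => simp
      | succ B ih =>
        rw [sum_range_succ]
        linarith [hrec B]
    linarith [tele A]

/-- Clipping is monotone and does not increase differences, so a strict rise of the clipped walk is
at least as large for `h`. -/
theorem HasPeaks.of_clip {h : ℕ → ℤ} {G : ℤ} {s W l P : ℕ} (hl : 1 ≤ l)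
    (H : HasPeaks (fun t => max (-G) (min (h t) G)) s W l P) : HasPeaks h s W l P := by
  obtain ⟨d, h1, h2, h3⟩ := H
  refine ⟨d, h1, h2, fun k hk => ?_⟩
  obtain ⟨u, h4, h5, h6, h7⟩ := h3 k hk
  simp only at h6 h7
  exact ⟨u, h4, h5, by omega, by omega⟩

/-- The time spent in the strip `|h| < G` is bounded by the number of peaks and valleys of `h`. -/
theorem exists_hasPeaks_of_inside {h : ℕ → ℤ} (hstep : ∀ t, |h (t + 1) - h t| = 1) {G : ℤ}
    (hG : 0 ≤ G) (s W A : ℕ) (hA : 2 * G < 2 ^ A) :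
    ∃ P : ℕ → ℕ, (∀ a, HasPeaks h s W (2 ^ a) (P a) ∧
        HasPeaks (fun t => -h t) s W (2 ^ a) (P a)) ∧
      (#{t ∈ range W | |h (s + t)| < G} : ℤ) ≤
        ∑ a ∈ range A, 2 ^ (a + 1) * (2 * (P a : ℤ) + 2) := by
  -- The clipped walk makes a unit step from every point strictly inside the strip, so its variation
  -- bounds the time spent there.
  set g : ℕ → ℤ := fun t => max (-G) (min (h t) G) with hg
  have h1 : ∀ t, |g (t + 1) - g t| ≤ 1 := by
    intro t
    have := (hstep t).le
    rw [abs_le] at this ⊢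
    simp only [hg]
    omega
  have h2 : ∀ t, |g t| ≤ G := by
    intro t
    rw [abs_le]
    simp only [hg]
    omega
  obtain ⟨P, hP, hsum⟩ := exists_hasPeaks_of_variation h1 h2 s W A hA
  refine ⟨P, fun a => ⟨(hP a).1.of_clip Nat.one_le_two_pow, ?_⟩, le_trans ?_ hsum⟩
  · refine HasPeaks.of_clip (G := G) Nat.one_le_two_pow ?_
    have := (hP a).2
    rwa [show (fun t => -g t) = fun t => max (-G) (min (-h t) G) by
      funext t; simp only [hg]; omega] at this
  · rw [← sum_boole]
    refine sum_le_sum fun t _ => ?_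
    split_ifs with ht
    · have h4 := hstep (s + t)
      rw [abs_lt] at ht
      have : |g (s + t + 1) - g (s + t)| = |h (s + t + 1) - h (s + t)| := by
        have := abs_le.1 h4.le
        congr 1
        simp only [hg]
        omega
      rw [this, h4]
    · exact abs_nonneg _

/-! ### The gain of two words in one window -/

theorem sum_Ico_chain {M : Type*} [AddCommMonoid M] (f : ℕ → M) (d : ℕ → ℕ) (P : ℕ)
    (hd : ∀ k < P, d k ≤ d (k + 1)) :
    d 0 ≤ d P ∧ ∑ k ∈ range P, ∑ t ∈ Ico (d k) (d (k + 1)), f t = ∑ t ∈ Ico (d 0) (d P), f t := by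
  induction P with
  | zero => simp
  | succ P ih =>
    obtain ⟨h1, h2⟩ := ih fun k hk => hd k (by omega)
    have h3 := hd P (Nat.lt_succ_self P)
    exact ⟨h1.trans h3, by rw [sum_range_succ, h2, sum_Ico_consecutive f h1 h3]⟩

theorem inv_add_le_min_div {l l' D D' : ℝ} (hl : 0 < l) (hl' : 0 < l') (hD : 0 < D) (hD' : 0 < D') :
    (2 * D / l + 2 * D' / l')⁻¹ ≤ min (l / (2 * D)) (l' / (2 * D')) := by
  refine le_min ?_ ?_
  · rw [← inv_div (2 * D) l]
    exact inv_anti₀ (by positivity) (le_add_of_nonneg_right (by positivity))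
  · rw [← inv_div (2 * D') l']
    exact inv_anti₀ (by positivity) (le_add_of_nonneg_left (by positivity))

/-- The tangent at `c` lies below the convex function `z⁻¹`; summing it over cells plays the role of
Jensen's inequality. -/
theorem tangent_le_inv {c z : ℝ} (hc : 0 < c) (hz : 0 < z) : 2 / c - z / c ^ 2 ≤ z⁻¹ := by
  rw [← sub_nonneg]
  have : z⁻¹ - (2 / c - z / c ^ 2) = (z - c) ^ 2 / (z * c ^ 2) := by
    field_simp
    ring
  rw [this]
  positivity

/-- The peaks of `w` and the valleys of `w'` in a common window, at scales `l` and `l'`. -/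
theorem IsProfile.window_gain {w w' : ℕ → Bool} {U : ℕ → ℕ → ℤ} (hU : IsProfile w w' U)
    {s W l P l' P' : ℕ} (hW : 0 < W) (hl : 1 ≤ l) (hl' : 1 ≤ l')
    (hP : HasPeaks (balance w) s W l P) (hP' : HasPeaks (fun r => -balance w' r) s W l' P')
    {ν ν' : ℝ} (hν : ν = l * P / W) (hν' : ν' = l' * P' / W) :
    (W : ℝ) ^ 2 * (ν * ν' * min ν ν' * ((min l l' : ℝ) ^ 2 / (l * l'))) / 32 ≤
      ((∑ t ∈ Ico s (s + W), ∑ r ∈ Ico s (s + W), mismatchInc w w' U t r : ℤ) : ℝ) := by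
  have hsum0 : (0 : ℝ) ≤
      ((∑ t ∈ Ico s (s + W), ∑ r ∈ Ico s (s + W), mismatchInc w w' U t r : ℤ) : ℝ) :=
    Int.cast_nonneg (sum_nonneg fun t _ => sum_nonneg fun r _ => hU.mismatchInc_nonneg t r)
  rcases Nat.eq_zero_or_pos P with rfl | hP0
  · simpa [hν] using hsum0
  rcases Nat.eq_zero_or_pos P' with rfl | hP0'
  · simpa [hν'] using hsum0
  have hWR : (0 : ℝ) < W := by exact_mod_cast hW
  have hlR : (0 : ℝ) < l := by exact_mod_cast hl
  have hlR' : (0 : ℝ) < l' := by exact_mod_cast hl'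
  have hPR : (0 : ℝ) < P := by exact_mod_cast hP0
  have hPR' : (0 : ℝ) < P' := by exact_mod_cast hP0'
  have hν0 : 0 < ν := by rw [hν]; positivity
  have hν0' : 0 < ν' := by rw [hν']; positivity
  obtain ⟨d, hd0, hdP, hd⟩ := hP
  obtain ⟨d', hd0', hdP', hd'⟩ := hP'
  have mono : ∀ k < P, d k < d (k + 1) := fun k hk => by
    obtain ⟨u, h1, h2, h3, h4⟩ := hd k hk
    rcases (h1.trans h2).eq_or_lt with h | h
    · have : u = d k := by omega
      subst this
      linarith
    · exact h
  have mono' : ∀ k < P', d' k < d' (k + 1) := fun k hk => by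
    obtain ⟨u, h1, h2, h3, h4⟩ := hd' k hk
    rcases (h1.trans h2).eq_or_lt with h | h
    · have : u = d' k := by omega
      subst this
      linarith
    · exact h
  have chain := fun f : ℕ → ℤ => sum_Ico_chain f d P fun k hk => (mono k hk).le
  have chain' := fun f : ℕ → ℤ => sum_Ico_chain f d' P' fun k hk => (mono' k hk).le
  set D : ℕ → ℝ := fun k => (d (k + 1) : ℝ) - d k with hD
  set D' : ℕ → ℝ := fun k => (d' (k + 1) : ℝ) - d' k with hD'
  have hDpos : ∀ k < P, 0 < D k := fun k hk => by
    have := mono k hk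
    simp only [hD, sub_pos]
    exact_mod_cast this
  have hDpos' : ∀ k < P', 0 < D' k := fun k hk => by
    have := mono' k hk
    simp only [hD', sub_pos]
    exact_mod_cast this
  have hDsum : ∑ k ∈ range P, D k ≤ W := by
    rw [hD, sum_range_sub (fun k => (d k : ℝ))]
    have h1 : (d P : ℝ) ≤ s + W := by exact_mod_cast hdP
    have h2 : (s : ℝ) ≤ d 0 := by exact_mod_cast hd0
    linarith
  have hDsum' : ∑ k ∈ range P', D' k ≤ W := by
    rw [hD', sum_range_sub (fun k => (d' k : ℝ))]
    have h1 : (d' P' : ℝ) ≤ s + W := by exact_mod_cast hdP'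
    have h2 : (s : ℝ) ≤ d' 0 := by exact_mod_cast hd0'
    linarith
  have embed : ∑ k ∈ range P, ∑ k' ∈ range P',
      ∑ t ∈ Ico (d k) (d (k + 1)), ∑ r ∈ Ico (d' k') (d' (k' + 1)), mismatchInc w w' U t r ≤
      ∑ t ∈ Ico s (s + W), ∑ r ∈ Ico s (s + W), mismatchInc w w' U t r := by
    have e1 : ∀ k, ∑ k' ∈ range P',
        ∑ t ∈ Ico (d k) (d (k + 1)), ∑ r ∈ Ico (d' k') (d' (k' + 1)), mismatchInc w w' U t r =
        ∑ t ∈ Ico (d k) (d (k + 1)), ∑ r ∈ Ico (d' 0) (d' P'), mismatchInc w w' U t r := by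
      intro k
      rw [sum_comm]
      exact sum_congr rfl fun t _ => (chain' _).2
    rw [sum_congr rfl fun k _ => e1 k, (chain _).2]
    refine (sum_le_sum fun t _ => sum_le_sum_of_subset_of_nonneg (Ico_subset_Ico hd0' hdP')
      fun r _ _ => hU.mismatchInc_nonneg t r).trans ?_
    exact sum_le_sum_of_subset_of_nonneg (Ico_subset_Ico hd0 hdP)
      fun t _ _ => sum_nonneg fun r _ => hU.mismatchInc_nonneg t r
  -- The value of `2 * D / l + 2 * D' / l'` at `D = W / P` and `D' = W / P'`, upper bounds for the
  -- mean lengths of the intervals.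
  set c := 2 * (1 / ν + 1 / ν') with hc
  have hc0 : 0 < c := by positivity
  set κ := (min l l' : ℝ) ^ 2 / 8 with hκ
  have hκ0 : 0 ≤ κ := by positivity
  have cell : ∀ k ∈ range P, ∀ k' ∈ range P',
      κ * (2 / c - (2 * D k / l + 2 * D' k' / l') / c ^ 2) ≤
      ((∑ t ∈ Ico (d k) (d (k + 1)), ∑ r ∈ Ico (d' k') (d' (k' + 1)),
        mismatchInc w w' U t r : ℤ) : ℝ) := by
    intro k hk k' hk'
    rw [mem_range] at hk hk'
    obtain ⟨u, h1, h2, h3, h4⟩ := hd k hk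
    obtain ⟨u', h1', h2', h3', h4'⟩ := hd' k' hk'
    have p1 := hDpos k hk
    have p2 := hDpos' k' hk'
    refine le_trans (mul_le_mul_of_nonneg_left ((tangent_le_inv hc0 (by positivity)).trans
      (inv_add_le_min_div hlR hlR' p1 p2)) hκ0) ?_
    exact hU.peak_valley_gain h1 h2 hl h3 h4 h1' h2' hl' h3' h4'
  have total : ∑ k ∈ range P, ∑ k' ∈ range P',
      (κ * (2 / c - (2 * D k / l + 2 * D' k' / l') / c ^ 2)) =
      κ * (P * P' * (2 / c) -
        (P' * (2 * (∑ k ∈ range P, D k) / l) + P * (2 * (∑ k ∈ range P', D' k) / l')) / c ^ 2) := by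
    simp only [← mul_sum, sum_sub_distrib, ← sum_div, sum_add_distrib, sum_const, card_range,
      nsmul_eq_mul]
    ring
  have lower : κ * (P * P' / c) ≤ κ * (P * P' * (2 / c) -
        (P' * (2 * (∑ k ∈ range P, D k) / l) + P * (2 * (∑ k ∈ range P', D' k) / l')) / c ^ 2) := by
    refine mul_le_mul_of_nonneg_left ?_ hκ0
    have b1 : P' * (2 * (∑ k ∈ range P, D k) / l) ≤ P' * (2 * W / l) := by gcongr
    have b2 : P * (2 * (∑ k ∈ range P', D' k) / l') ≤ P * (2 * W / l') := by gcongr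
    have b3 : (P' * (2 * W / l) + P * (2 * W / l') : ℝ) = P * P' * c := by
      rw [hc, hν, hν']
      field_simp
    have b4 : (P' * (2 * (∑ k ∈ range P, D k) / l) + P * (2 * (∑ k ∈ range P', D' k) / l')) / c ^ 2
        ≤ P * P' * c / c ^ 2 := by
      rw [← b3]
      gcongr
    have b5 : (P * P' * c / c ^ 2 : ℝ) = P * P' / c := by
      field_simp
    have b6 : (P * P' * (2 / c) : ℝ) = P * P' / c + P * P' / c := by ring
    linarith
  have upper := Int.cast_le (R := ℝ) |>.2 embed
  have mid := sum_le_sum fun k hk => sum_le_sum fun k' hk' => cell k hk k' hk'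
  rw [total] at mid
  push_cast at mid upper ⊢
  refine le_trans ?_ (lower.trans (mid.trans upper))
  have hmin : min ν ν' / 2 ≤ ν * ν' / (ν + ν') := by
    rw [div_le_div_iff₀ (by norm_num) (by positivity)]
    rcases le_total ν ν' with h | h
    · rw [min_eq_left h]; nlinarith
    · rw [min_eq_right h]; nlinarith
  have e2 : κ * (P * P' / c) =
      (W : ℝ) ^ 2 * (ν * ν' * (ν * ν' / (ν + ν')) * ((min l l' : ℝ) ^ 2 / (l * l'))) / 16 := by
    have eP : (P : ℝ) = ν * W / l := by rw [hν]; field_simp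
    have eP' : (P' : ℝ) = ν' * W / l' := by rw [hν']; field_simp
    rw [eP, eP', hκ, hc]
    field_simp
    ring
  rw [e2]
  have e3 : (W : ℝ) ^ 2 * (ν * ν' * min ν ν' * ((min l l' : ℝ) ^ 2 / (l * l'))) / 32 =
      (W : ℝ) ^ 2 * (ν * ν' * (min ν ν' / 2) * ((min l l' : ℝ) ^ 2 / (l * l'))) / 16 := by ring
  rw [e3]
  gcongr

/-! ### Pigeonhole on scales -/

theorem sum_three_quarters_pow_le (ξ : ℕ) : ∑ j ∈ range ξ, (3 / 4 : ℝ) ^ j ≤ 4 := by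
  rw [geom_sum_eq (by norm_num)]
  have : (0 : ℝ) ≤ (3 / 4) ^ ξ := by positivity
  rw [div_le_iff_of_neg (by norm_num)]
  linarith

theorem sum_bin_weights_le (ξ r : ℕ) :
    ∑ a ∈ range (r * ξ), (3 / 4 : ℝ) ^ min (a % ξ) (ξ - a % ξ) ≤ 8 * r := by
  induction r with
  | zero => simp
  | succ r ih =>
    rw [Nat.succ_mul, sum_range_add]
    have h1 : ∑ j ∈ range ξ, (3 / 4 : ℝ) ^ min ((r * ξ + j) % ξ) (ξ - (r * ξ + j) % ξ) ≤
        ∑ j ∈ range ξ, ((3 / 4 : ℝ) ^ j + (3 / 4) ^ (ξ - 1 - j)) := by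
      refine sum_le_sum fun j hj => ?_
      rw [mem_range] at hj
      rw [Nat.mul_add_mod_self_right, Nat.mod_eq_of_lt hj]
      have p1 : (0 : ℝ) ≤ (3 / 4) ^ j := by positivity
      have p2 : (0 : ℝ) ≤ (3 / 4) ^ (ξ - 1 - j) := by positivity
      rcases le_total j (ξ - j) with h | h
      · rw [min_eq_left h]
        linarith
      · rw [min_eq_right h]
        have : (3 / 4 : ℝ) ^ (ξ - j) ≤ (3 / 4) ^ (ξ - 1 - j) :=
          pow_le_pow_of_le_one (by norm_num) (by norm_num) (by omega)
        linarith
    rw [sum_add_distrib, sum_range_reflect (fun j => (3 / 4 : ℝ) ^ j)] at h1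
    have := sum_three_quarters_pow_le ξ
    push_cast
    linarith

/-- Among `r` multiscale mass distributions on `(r - 1) * ξ` scales there are two which have much
mass on scales at bounded distance. -/
theorem exists_close_scales {ι : Type*} (S : Finset ι) {r ξ A : ℕ} (hr : 2 ≤ r) (hS : r ≤ #S)
    (hξ : 1 ≤ ξ) (hA : A ≤ (r - 1) * ξ) (ν : ι → ℕ → ℝ) (hν : ∀ i a, 0 ≤ ν i a) {c : ℝ}
    (hc : 0 < c) (hmass : ∀ i ∈ S, c ≤ ∑ a ∈ range A, ν i a) :
    ∃ i ∈ S, ∃ j ∈ S, i ≠ j ∧ ∃ a b : ℕ, (c / (8 * r)) ^ 3 / 2 ^ ξ ≤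
      ν i a * ν j b * min (ν i a) (ν j b) * ((min (2 ^ a) (2 ^ b) : ℝ) ^ 2 / (2 ^ a * 2 ^ b)) := by
  -- `δ a` measures the distance from `a` to the ends of its bin. The weights `(3/4) ^ δ a` favour
  -- scales near the ends, and their sum is at most `8 * (r - 1)`, just short of `8 * r`; hence
  -- every distribution exceeds its weighted threshold somewhere.
  set δ : ℕ → ℕ := fun a => min (a % ξ) (ξ - a % ξ) with hδ
  have hrR : (2 : ℝ) ≤ r := by exact_mod_cast hr
  have hpick : ∀ i ∈ S, ∃ a < A, c / (8 * r) * (3 / 4) ^ δ a ≤ ν i a := by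
    intro i hi
    by_contra! hcon
    have h1 : ∑ a ∈ range A, ν i a ≤ ∑ a ∈ range A, c / (8 * r) * (3 / 4 : ℝ) ^ δ a :=
      sum_le_sum fun a ha => (hcon a (mem_range.1 ha)).le
    have h2 : ∑ a ∈ range A, (3 / 4 : ℝ) ^ δ a ≤ 8 * (r - 1 : ℕ) :=
      le_trans (sum_le_sum_of_subset_of_nonneg (range_subset_range.2 hA)
        fun _ _ _ => by positivity) (sum_bin_weights_le ξ (r - 1))
    rw [Nat.cast_sub (by omega), Nat.cast_one] at h2
    rw [← mul_sum] at h1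
    have h3 : c / (8 * r) * ∑ a ∈ range A, (3 / 4 : ℝ) ^ δ a ≤ c / (8 * r) * (8 * (r - 1)) :=
      mul_le_mul_of_nonneg_left h2 (by positivity)
    have h4 : c / (8 * r) * (8 * (r - 1)) = c - c / r := by
      field_simp
    have h5 : 0 < c / r := by positivity
    linarith [hmass i hi]
  choose! a ha hνa using hpick
  obtain ⟨i, hi, j, hj, hij, hbin⟩ := exists_ne_map_eq_of_card_lt_of_maps_to
    (s := S) (t := range (r - 1)) (f := fun i => a i / ξ) (by rw [card_range]; omega)
    (fun i hi => by
      simp only [coe_range, Set.mem_Iio]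
      exact Nat.div_lt_of_lt_mul (by rw [mul_comm]; exact (ha i hi).trans_le hA))
  refine ⟨i, hi, j, hj, hij, a i, a j, ?_⟩
  have hm1 := Nat.div_add_mod (a i) ξ
  have hm2 := Nat.div_add_mod (a j) ξ
  have hlt1 := Nat.mod_lt (a i) (show 0 < ξ by omega)
  have hlt2 := Nat.mod_lt (a j) (show 0 < ξ by omega)
  rw [hbin] at hm1
  -- Scales deep inside a common bin are closer together than `ξ`. This gains a factor `2 ^ (x +
  -- y)`, which outweighs the loss `(3/4) ^ (2 * (x + y))` from the weights because `2 * (3/4) ^ 2 =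
  -- 9/8`.
  have hdist : a i + δ (a i) + δ (a j) ≤ a j + ξ ∧ a j + δ (a i) + δ (a j) ≤ a i + ξ := by
    simp only [hδ]
    omega
  set x := δ (a i)
  set y := δ (a j)
  have hscale : (2 : ℝ) ^ (x + y) / 2 ^ ξ ≤
      (min (2 ^ a i) (2 ^ a j) : ℝ) ^ 2 / (2 ^ a i * 2 ^ a j) := by
    rw [div_le_div_iff₀ (by positivity) (by positivity)]
    rcases le_total (a i) (a j) with h | h
    · rw [min_eq_left (pow_le_pow_right₀ (by norm_num) h)]
      calc (2 : ℝ) ^ (x + y) * (2 ^ a i * 2 ^ a j) = 2 ^ (a i + (a j + x + y)) := by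
            rw [← pow_add, ← pow_add]; congr 1; ring
        _ ≤ 2 ^ (a i + (a i + ξ)) := pow_le_pow_right₀ (by norm_num) (by omega)
        _ = (2 ^ a i) ^ 2 * 2 ^ ξ := by rw [← pow_mul, ← pow_add]; congr 1; ring
    · rw [min_eq_right (pow_le_pow_right₀ (by norm_num) h)]
      calc (2 : ℝ) ^ (x + y) * (2 ^ a i * 2 ^ a j) = 2 ^ (a j + (a i + x + y)) := by
            rw [← pow_add, ← pow_add]; congr 1; ring
        _ ≤ 2 ^ (a j + (a j + ξ)) := pow_le_pow_right₀ (by norm_num) (by omega)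
        _ = (2 ^ a j) ^ 2 * 2 ^ ξ := by rw [← pow_mul, ← pow_add]; congr 1; ring
  set γ := c / (8 * r) with hγ
  have hγ0 : 0 < γ := by positivity
  have hmin : γ * (3 / 4) ^ (x + y) ≤ min (ν i (a i)) (ν j (a j)) := by
    refine le_min (le_trans ?_ (hνa i hi)) (le_trans ?_ (hνa j hj))
    · exact mul_le_mul_of_nonneg_left
        (pow_le_pow_of_le_one (by norm_num) (by norm_num) (by omega)) hγ0.le
    · exact mul_le_mul_of_nonneg_left
        (pow_le_pow_of_le_one (by norm_num) (by norm_num) (by omega)) hγ0.le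
  calc γ ^ 3 / 2 ^ ξ ≤ γ ^ 3 * ((9 / 8) ^ (x + y) / 2 ^ ξ) := by
        rw [div_eq_mul_one_div]
        gcongr
        exact one_le_pow₀ (by norm_num)
    _ = γ * (3 / 4) ^ x * (γ * (3 / 4) ^ y) * (γ * (3 / 4) ^ (x + y)) * (2 ^ (x + y) / 2 ^ ξ) := by
        have : (9 / 8 : ℝ) ^ (x + y) = (3 / 4) ^ (x + y) * (3 / 4) ^ (x + y) * 2 ^ (x + y) := by
          rw [← mul_pow, ← mul_pow]; norm_num
        rw [this, pow_add (3 / 4 : ℝ) x y]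
        ring
    _ ≤ _ := by
        gcongr
        · exact mul_nonneg (mul_nonneg (hν _ _) (hν _ _)) (le_min (hν _ _) (hν _ _))
        · exact mul_nonneg (hν _ _) (hν _ _)
        · exact hν _ _
        · exact hνa i hi
        · exact hνa j hj

/-! ### Balanced binary words -/

/-- Take the common `true`s before time `t` and the common `false`s after it, or the other way
round. -/
theorem IsProfile.add_balance_le {w w' : ℕ → Bool} {U : ℕ → ℕ → ℤ} (hU : IsProfile w w' U)
    {m n t : ℕ} (ht : t ≤ n) (hm : ∀ b, letterCount w b n = m) (hm' : ∀ b, letterCount w' b n = m) :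
    m + min (balance w t) (balance w' t) ≤ U n n ∧
      m + min (-balance w t) (-balance w' t) ≤ U n n := by
  have a1 := hU.add_min_letterCount_le true (Nat.zero_le t) (Nat.zero_le t)
  have a2 := hU.add_min_letterCount_le false (Nat.zero_le t) (Nat.zero_le t)
  have a3 := hU.add_min_letterCount_le true ht ht
  have a4 := hU.add_min_letterCount_le false ht ht
  have z := hU.zero_left 0
  have b1 := two_mul_letterCount_true w t
  have b2 := two_mul_letterCount_true w' t
  have b3 := two_mul_letterCount_false w t
  have b4 := two_mul_letterCount_false w' t
  have c1 := hm true
  have c2 := hm false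
  have c3 := hm' true
  have c4 := hm' false
  simp only [letterCount_zero, sub_zero] at a1 a2
  constructor <;> omega

/-- Twice the difference of counts is at most `W` from the times plus `2 * (G + W) ≤ 3 * W` from the
balances; this fixes the half-width `2 * W` of the band. -/
theorem letterCount_near {w w' : ℕ → Bool} {s W G t r : ℕ}
    (h : |balance w t| ≤ G + W) (h' : |balance w' r| ≤ G + W) (hGW : G ≤ W / 2)
    (ht : s ≤ t) (ht' : t ≤ s + W) (hr : s ≤ r) (hr' : r ≤ s + W) (b : Bool) :
    |letterCount w' b r - letterCount w b t| ≤ (2 * W : ℕ) := by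
  have b1 := two_mul_letterCount_true w t
  have b2 := two_mul_letterCount_true w' r
  have b3 := two_mul_letterCount_false w t
  have b4 := two_mul_letterCount_false w' r
  rw [abs_le] at *
  cases b <;> constructor <;> omega

theorem abs_balance_lt_of_near {w : ℕ → Bool} {s W G t₀ : ℕ} (h₀ : |balance w t₀| < G)
    (hs : s ≤ t₀) (hs' : t₀ ≤ s + W) {t : ℕ} (ht : s ≤ t) (ht' : t ≤ s + W) :
    |balance w t| ≤ G + W := by
  have lip : ∀ a k : ℕ, |balance w (a + k) - balance w a| ≤ k := by
    intro a k
    induction k with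
    | zero => simp
    | succ k ih =>
      have := abs_balance_succ_sub w (a + k)
      rw [abs_le] at *
      rw [← add_assoc]
      push_cast
      constructor <;> linarith
  rcases le_total t₀ t with h | h
  · have := lip t₀ (t - t₀)
    rw [Nat.add_sub_cancel' h] at this
    rw [abs_lt] at h₀
    rw [abs_le] at *
    omega
  · have := lip t (t₀ - t)
    rw [Nat.add_sub_cancel' h] at this
    rw [abs_lt] at h₀
    rw [abs_le] at *
    omega

/-- At most one value is above the strip and at most one below it: this is the origin of the 2 in `r
+ 2`. -/
theorem card_inside_ge {N G : ℕ} (x : Fin N → ℤ)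
    (h1 : ∀ i j, i ≠ j → min (x i) (x j) < G) (h2 : ∀ i j, i ≠ j → min (-x i) (-x j) < G) :
    N ≤ #{i | |x i| < G} + 2 := by
  have c1 : #{i | (G : ℤ) ≤ x i} ≤ 1 := by
    rw [card_le_one]
    intro i hi j hj
    simp only [mem_filter, mem_univ, true_and] at hi hj
    by_contra hij
    have := h1 i j hij
    omega
  have c2 : #{i | (G : ℤ) ≤ -x i} ≤ 1 := by
    rw [card_le_one]
    intro i hi j hj
    simp only [mem_filter, mem_univ, true_and] at hi hj
    by_contra hij
    have := h2 i j hij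
    omega
  have hcov : (univ : Finset (Fin N)) ⊆ (univ.filter (fun i => |x i| < (G : ℤ)) ∪
      univ.filter (fun i => (G : ℤ) ≤ x i)) ∪ univ.filter (fun i => (G : ℤ) ≤ -x i) := by
    intro i _
    simp only [mem_union, mem_filter, mem_univ, true_and, abs_lt]
    omega
  have u0 := card_le_card hcov
  rw [card_univ, Fintype.card_fin] at u0
  have u1 := card_union_le (univ.filter (fun i => |x i| < (G : ℤ)) ∪
    univ.filter (fun i => (G : ℤ) ≤ x i)) (univ.filter (fun i => (G : ℤ) ≤ -x i))
  have u2 := card_union_le (univ.filter (fun i => |x i| < (G : ℤ)))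
    (univ.filter (fun i => (G : ℤ) ≤ x i))
  omega

/-- If at every time all but two of `r + 2` functions are inside, then at least `r` of them are
inside for a quarter of the time. -/
theorem card_often_inside_ge {r W : ℕ} (hW : 0 < W) (I : Fin (r + 2) → Finset ℕ)
    (hI : ∀ i, I i ⊆ range W) (h : ∀ t < W, r ≤ #{i | t ∈ I i}) :
    r ≤ #{i | W ≤ 4 * #(I i)} := by
  by_contra! hcon
  have e : ∑ i, #(I i) = ∑ t ∈ range W, #{i | t ∈ I i} := by
    have h1 : ∀ i, #(I i) = ∑ t ∈ range W, if t ∈ I i then 1 else 0 := fun i => by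
      rw [← card_filter, filter_mem_eq_inter, inter_eq_right.2 (hI i)]
    rw [sum_congr rfl fun i _ => h1 i, sum_comm]
    exact sum_congr rfl fun t _ => (card_filter _ _).symm
  have lower : W * r ≤ ∑ i, #(I i) := by
    rw [e]
    calc W * r = ∑ t ∈ range W, r := by simp
      _ ≤ _ := sum_le_sum fun t ht => h t (mem_range.1 ht)
  have upper : ∑ i, 4 * #(I i) ≤ ∑ i, (W + if W ≤ 4 * #(I i) then 3 * W else 0) := by
    refine sum_le_sum fun i _ => ?_
    have := card_le_card (hI i)
    rw [card_range] at this
    split_ifs <;> omega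
  have strict : ∑ i, 4 * #(I i) < ∑ i, (W + if W ≤ 4 * #(I i) then 3 * W else 0) := by
    obtain ⟨i, hi⟩ : ∃ i, ¬ W ≤ 4 * #(I i) := by
      by_contra! hall
      rw [filter_true_of_mem fun i _ => hall i] at hcon
      simp at hcon
    refine sum_lt_sum (fun i _ => ?_) ⟨i, mem_univ _, ?_⟩
    · have := card_le_card (hI i)
      rw [card_range] at this
      split_ifs <;> omega
    · rw [if_neg hi]
      omega
  rw [← mul_sum, sum_add_distrib, sum_const, card_univ, Fintype.card_fin, ← sum_filter, sum_const,
    smul_eq_mul, smul_eq_mul] at strict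
  have h5 : #{i | W ≤ 4 * #(I i)} * (3 * W) ≤ (r - 1) * (3 * W) :=
    Nat.mul_le_mul_right _ (by omega)
  have h6 : (r - 1) * (3 * W) + 3 * W = r * (3 * W) := by
    rw [← Nat.succ_mul]; congr 1; omega
  have h7 : (r + 2) * W = r * W + 2 * W := by ring
  nlinarith

/-- In every window there is a pair of words with a large gain. -/
theorem exists_window_gain {r G ξ A W : ℕ} (hr : 2 ≤ r) (hG : 1 ≤ G) (hξ : 1 ≤ ξ)
    (hA1 : 2 * G < 2 ^ A) (hA2 : 2 ^ A ≤ 4 * G) (hA : A ≤ (r - 1) * ξ) (hW : W = 128 * G)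
    (w : Fin (r + 2) → ℕ → Bool) (U : Fin (r + 2) → Fin (r + 2) → ℕ → ℕ → ℤ)
    (hU : ∀ i j, IsProfile (w i) (w j) (U i j)) (s : ℕ)
    (hin : ∀ t < W, r ≤ #{i | |balance (w i) (s + t)| < G}) :
    ∃ i j, i ≠ j ∧
      (∀ t, s ≤ t → t ≤ s + W → |balance (w i) t| ≤ G + W) ∧
      (∀ t, s ≤ t → t ≤ s + W → |balance (w j) t| ≤ G + W) ∧
      (W : ℝ) ^ 2 / (2 ^ 29 * r ^ 3 * 2 ^ ξ) ≤
        ((∑ t ∈ Ico s (s + W), ∑ u ∈ Ico s (s + W), mismatchInc (w i) (w j) (U i j) t u : ℤ) : ℝ) := by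
  have hW0 : 0 < W := by omega
  set I : Fin (r + 2) → Finset ℕ := fun i => {t ∈ range W | |balance (w i) (s + t)| < G} with hI
  have hS := card_often_inside_ge hW0 I (fun i => filter_subset _ _) (fun t ht => by
    refine (hin t ht).trans (le_of_eq ?_)
    congr 1
    ext i
    simp [hI, ht])
  have hstep : ∀ i t, |balance (w i) (t + 1) - balance (w i) t| = 1 := fun i t => by
    rw [balance_succ]
    split_ifs <;> simp
  choose P hP hPsum using fun i => exists_hasPeaks_of_inside (hstep i) (G := G) (by omega) s W A
    (by exact_mod_cast hA1)
  have hWR : (0 : ℝ) < W := by exact_mod_cast hW0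
  have hrR : (0 : ℝ) < r := by exact_mod_cast (by omega : 0 < r)
  have hmass : ∀ i ∈ ({i | W ≤ 4 * #(I i)} : Finset (Fin (r + 2))),
      (1 / 32 : ℝ) ≤ ∑ a ∈ range A, ((2 ^ a : ℕ) : ℝ) * P i a / W := by
    intro i hi
    simp only [mem_filter, mem_univ, true_and] at hi
    have h1 := hPsum i
    have h2 : ∑ a ∈ range A, (2 : ℤ) ^ (a + 1) * (2 * (P i a : ℤ) + 2) =
        4 * ∑ a ∈ range A, ((2 ^ a : ℕ) : ℤ) * P i a + 4 * (2 ^ A - 1) := by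
      rw [← mul_geom_sum, mul_sum, mul_sum, mul_sum, ← sum_add_distrib]
      refine sum_congr rfl fun a _ => ?_
      push_cast
      ring
    rw [h2] at h1
    have hi' : (W : ℤ) ≤ 4 * (#(I i) : ℤ) := by exact_mod_cast hi
    have hA2' : (2 : ℤ) ^ A ≤ 4 * G := by exact_mod_cast hA2
    have hWZ : (W : ℤ) = 128 * G := by exact_mod_cast hW
    -- A time of at least `W / 4` is spent inside. The term `4 * (2 ^ A - 1)`, coming from the `+ 2`
    -- at each scale, is below `16 * G = W / 8`, so peaks account for the rest. This is why `W = 128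
    -- * G`.
    have h3 : (W : ℤ) ≤ 32 * ∑ a ∈ range A, ((2 ^ a : ℕ) : ℤ) * P i a := by
      simp only [hI] at hi'
      linarith
    have h4 : (W : ℝ) ≤ 32 * ∑ a ∈ range A, ((2 ^ a : ℕ) : ℝ) * P i a := by exact_mod_cast h3
    rw [← sum_div, div_le_div_iff₀ (by norm_num) hWR]
    linarith
  obtain ⟨i, hi, j, hj, hij, a, b, hab⟩ := exists_close_scales _ hr hS hξ hA
    (fun i a => ((2 ^ a : ℕ) : ℝ) * P i a / W) (fun i a => by positivity) (by norm_num) hmass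
  have near : ∀ i ∈ ({i | W ≤ 4 * #(I i)} : Finset (Fin (r + 2))),
      ∀ t, s ≤ t → t ≤ s + W → |balance (w i) t| ≤ G + W := by
    intro i hi t ht ht'
    simp only [mem_filter, mem_univ, true_and] at hi
    obtain ⟨t₀, ht₀⟩ : (I i).Nonempty := card_pos.1 (by omega)
    simp only [hI, mem_filter, mem_range] at ht₀
    exact abs_balance_lt_of_near ht₀.2 (Nat.le_add_right _ _) (by omega) ht ht'
  refine ⟨i, j, hij, near i hi, near j hj, le_trans ?_ ((hU i j).window_gain hW0
    Nat.one_le_two_pow Nat.one_le_two_pow (hP i a).1 (hP j b).2 rfl rfl)⟩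
  push_cast at hab ⊢
  calc (W : ℝ) ^ 2 / (2 ^ 29 * r ^ 3 * 2 ^ ξ) =
      (W : ℝ) ^ 2 * ((1 / 32 / (8 * r)) ^ 3 / 2 ^ ξ) / 32 := by
        field_simp
        norm_num
    _ ≤ _ := by gcongr

/-- Among `r + 2` balanced binary words of length `2 * m` some two have a longest common
subsequence of length at least `m + G`. -/
theorem exists_pair_gain {r G ξ A m : ℕ} (hr : 2 ≤ r) (hG : 1 ≤ G) (hξ : 1 ≤ ξ)
    (hA1 : 2 * G < 2 ^ A) (hA2 : 2 ^ A ≤ 4 * G) (hA : A ≤ (r - 1) * ξ)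
    (hm : 2 ^ 44 * r ^ 5 * 2 ^ ξ * G ≤ m) (w : Fin (r + 2) → ℕ → Bool)
    (hw : ∀ i b, letterCount (w i) b (2 * m) = m) :
    ∃ i j, i ≠ j ∧ m + G ≤ pairLCS (wordPrefix (w i) (2 * m)) (wordPrefix (w j) (2 * m)) := by
  by_contra! hcon
  set U : Fin (r + 2) → Fin (r + 2) → ℕ → ℕ → ℤ :=
    fun i j t u => (pairLCS (wordPrefix (w i) t) (wordPrefix (w j) u) : ℤ) with hUdef
  have hU : ∀ i j, IsProfile (w i) (w j) (U i j) := fun i j => isProfile_pairLCS _ _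
  have hlt : ∀ i j, i ≠ j → U i j (2 * m) (2 * m) < m + G := fun i j hij => by
    simp only [hUdef]
    exact_mod_cast hcon i j hij
  clear_value U
  obtain ⟨W, hW⟩ : ∃ W, W = 128 * G := ⟨_, rfl⟩
  have hW0 : 0 < W := by omega
  have hWR : (0 : ℝ) < W := by exact_mod_cast hW0
  have hrR : (0 : ℝ) < r := by exact_mod_cast (by omega : 0 < r)
  set B := 2 * m / W with hB
  set near : Fin (r + 2) → ℕ → Prop :=
    fun i b => ∀ t, b * W ≤ t → t ≤ b * W + W → |balance (w i) t| ≤ G + W with hnear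
  set win : Fin (r + 2) → Fin (r + 2) → ℕ → ℤ := fun i j b =>
    ∑ t ∈ Ico (b * W) (b * W + W), ∑ u ∈ Ico (b * W) (b * W + W),
      mismatchInc (w i) (w j) (U i j) t u with hwin
  have hwin0 : ∀ i j b, 0 ≤ win i j b := fun i j b =>
    sum_nonneg fun t _ => sum_nonneg fun u _ => (hU i j).mismatchInc_nonneg t u
  have hfit : ∀ b < B, b * W + W ≤ 2 * m := fun b hb => by
    rw [← Nat.succ_mul]
    exact (Nat.mul_le_mul_right W hb).trans (Nat.div_mul_le_self _ _)
  classical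
  -- Upper bound per pair from `slack` with `R = 2 * W`, applied to the disjoint diagonal squares of
  -- the windows where both walks remain near the strip.
  have pair : ∀ i j, i ≠ j → ∑ b ∈ range B, (if near i b ∧ near j b then win i j b else 0) ≤
      (8 * W + 2) * (G + 4 * W) := by
    intro i j hij
    rw [← sum_filter]
    set Z := ({b ∈ range B | near i b ∧ near j b} : Finset ℕ).biUnion
      (fun b => Ico (b * W) (b * W + W) ×ˢ Ico (b * W) (b * W + W)) with hZ
    have hdisj : Set.PairwiseDisjoint (({b ∈ range B | near i b ∧ near j b} : Finset ℕ) : Set ℕ)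
        (fun b => Ico (b * W) (b * W + W) ×ˢ Ico (b * W) (b * W + W)) := by
      intro b _ b' _ hbb
      refine disjoint_left.2 fun z hz hz' => hbb ?_
      simp only [mem_product, mem_Ico] at hz hz'
      have h1 : z.1 / W = b := Nat.div_eq_of_lt_le hz.1.1 (by rw [Nat.succ_mul]; exact hz.1.2)
      have h2 : z.1 / W = b' := Nat.div_eq_of_lt_le hz'.1.1 (by rw [Nat.succ_mul]; exact hz'.1.2)
      rw [← h1, h2]
    have e : ∑ z ∈ Z, mismatchInc (w i) (w j) (U i j) z.1 z.2 =
        ∑ b ∈ range B with near i b ∧ near j b, win i j b := by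
      rw [hZ, sum_biUnion hdisj]
      exact sum_congr rfl fun b _ => sum_product _ _ _
    have hs := (hU i j).slack (2 * W) m (2 * m) (hw i) (hw j) Z
      (by
        intro z hz
        simp only [hZ, mem_biUnion, mem_filter, mem_range, mem_product, mem_Ico] at hz ⊢
        obtain ⟨b, ⟨hb, -⟩, hz⟩ := hz
        have := hfit b hb
        omega)
      (by
        intro z hz b
        simp only [hZ, mem_biUnion, mem_filter, mem_range, mem_product, mem_Ico] at hz
        obtain ⟨c, ⟨hc, hi, hj⟩, hz⟩ := hz
        have hGW : G ≤ W / 2 := by omega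
        exact ⟨letterCount_near (s := c * W) (hi z.1 (by omega) (by omega))
            (hj z.2 (by omega) (by omega)) hGW (by omega) (by omega) (by omega) (by omega) b,
          letterCount_near (s := c * W) (hi z.1 (by omega) (by omega))
            (hj (z.2 + 1) (by omega) (by omega)) hGW (by omega) (by omega) (by omega) (by omega) b⟩)
    rw [e] at hs
    have h3 := mul_le_mul_of_nonneg_left (hlt i j hij).le
      (by positivity : (0 : ℤ) ≤ 4 * (2 * W : ℕ) + 2)
    push_cast at hs h3
    linarith
  have window : ∀ b ∈ range B, (W : ℝ) ^ 2 / (2 ^ 29 * r ^ 3 * 2 ^ ξ) ≤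
      ((∑ p : Fin (r + 2) × Fin (r + 2), (if p.1 ≠ p.2 then
        (if near p.1 b ∧ near p.2 b then win p.1 p.2 b else 0) else 0) : ℤ) : ℝ) := by
    intro b hb
    rw [mem_range] at hb
    obtain ⟨i, j, hij, hi, hj, hg⟩ := exists_window_gain hr hG hξ hA1 hA2 hA hW w U hU (b * W) (by
      intro t ht
      have hle : b * W + t ≤ 2 * m := by have := hfit b hb; omega
      have := card_inside_ge (G := G) (fun i => balance (w i) (b * W + t))
        (fun i j hij => by
          have h1 := ((hU i j).add_balance_le hle (hw i) (hw j)).1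
          have h2 := hlt i j hij
          linarith)
        (fun i j hij => by
          have h1 := ((hU i j).add_balance_le hle (hw i) (hw j)).2
          have h2 := hlt i j hij
          linarith)
      omega)
    refine hg.trans (Int.cast_le.2 ?_)
    refine le_trans (le_of_eq ?_) (single_le_sum (f := fun p : Fin (r + 2) × Fin (r + 2) =>
      (if p.1 ≠ p.2 then (if near p.1 b ∧ near p.2 b then win p.1 p.2 b else 0) else 0))
      (fun p _ => ?_) (mem_univ (i, j)))
    · simp only
      rw [if_pos hij, if_pos ⟨hi, hj⟩]
    · have := hwin0 p.1 p.2 b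
      split_ifs <;> simp [this]
  have total := sum_le_sum window
  rw [sum_const, card_range, nsmul_eq_mul, ← Int.cast_sum, sum_comm] at total
  have pairs : ∑ p : Fin (r + 2) × Fin (r + 2), ∑ b ∈ range B, (if p.1 ≠ p.2 then
        (if near p.1 b ∧ near p.2 b then win p.1 p.2 b else 0) else 0) ≤
      ∑ p : Fin (r + 2) × Fin (r + 2), ((8 * W + 2) * (G + 4 * W) : ℤ) := by
    refine sum_le_sum fun p _ => ?_
    by_cases hp : p.1 = p.2
    · simp only [hp, ne_eq, not_true_eq_false, if_false, sum_const_zero]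
      positivity
    · simp only [ne_eq, hp, not_false_eq_true, if_true]
      exact pair p.1 p.2 hp
  rw [sum_const, card_univ, Fintype.card_prod, Fintype.card_fin, nsmul_eq_mul] at pairs
  have total' := total.trans (Int.cast_le.2 pairs)
  push_cast at total'
  -- With this many windows the total gain is at least `2 ^ 9 * r ^ 2 * W ^ 2`, while all pairs
  -- together allow at most `4 * 45 * r ^ 2 * W ^ 2`.
  have hBlow : 2 ^ 38 * r ^ 5 * 2 ^ ξ ≤ B := by
    rw [hB, Nat.le_div_iff_mul_le hW0, hW]
    calc 2 ^ 38 * r ^ 5 * 2 ^ ξ * (128 * G) = 2 * (2 ^ 44 * r ^ 5 * 2 ^ ξ * G) := by ring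
      _ ≤ 2 * m := Nat.mul_le_mul_left 2 hm
  have hBR : (2 ^ 38 * r ^ 5 * 2 ^ ξ : ℝ) ≤ B := by exact_mod_cast hBlow
  have low : 2 ^ 9 * (r : ℝ) ^ 2 * W ^ 2 ≤ B * ((W : ℝ) ^ 2 / (2 ^ 29 * r ^ 3 * 2 ^ ξ)) := by
    calc 2 ^ 9 * (r : ℝ) ^ 2 * W ^ 2 =
        (2 ^ 38 * r ^ 5 * 2 ^ ξ) * ((W : ℝ) ^ 2 / (2 ^ 29 * r ^ 3 * 2 ^ ξ)) := by
          field_simp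
      _ ≤ _ := by gcongr
  have hr2 : (2 : ℝ) ≤ r := by exact_mod_cast hr
  have hW1 : (2 : ℝ) ≤ W := by exact_mod_cast (by omega : 2 ≤ W)
  have hGW : (G : ℝ) ≤ W := by exact_mod_cast (by omega : G ≤ W)
  have up : ((r : ℝ) + 2) * (r + 2) * ((8 * W + 2) * (G + 4 * W)) ≤
      (2 * r) * (2 * r) * ((9 * W) * (5 * W)) := by
    gcongr <;> linarith
  have pos : 0 < (r : ℝ) ^ 2 * W ^ 2 := by positivity
  nlinarith

/-! ### Choice of the gain -/

theorem letterCount_eq_count (w : ℕ → Bool) (b : Bool) (t : ℕ) :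
    letterCount w b t = ((wordPrefix w t).count b : ℤ) := by
  induction t with
  | zero => simp [wordPrefix]
  | succ t ih =>
    rw [letterCount_succ, wordPrefix_succ, List.count_append, ih, List.count_singleton]
    push_cast
    simp

theorem exists_wordPrefix_eq (u : List Bool) : ∃ w : ℕ → Bool, wordPrefix w u.length = u := by
  refine ⟨fun t => u.getD t false, ?_⟩
  refine List.ext_getElem (by simp [wordPrefix]) fun i h1 h2 => ?_
  simp [wordPrefix, List.getD_eq_getElem?_getD, h2]

/-- Scales suitable for a given gain `G`. -/
theorem exists_scales {r G : ℕ} (hr : 2 ≤ r) (hG : 1 ≤ G) :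
    ∃ A ξ : ℕ, 1 ≤ ξ ∧ 2 * G < 2 ^ A ∧ 2 ^ A ≤ 4 * G ∧ A ≤ (r - 1) * ξ ∧
      2 ^ ((ξ - 1) * (r - 1)) ≤ 2 * G := by
  have h1 : 2 ^ Nat.log 2 (2 * G) ≤ 2 * G := Nat.pow_log_le_self 2 (by omega)
  have h2 : 2 * G < 2 ^ (Nat.log 2 (2 * G) + 1) := Nat.lt_pow_succ_log_self (by norm_num) _
  set L := Nat.log 2 (2 * G)
  have h3 := Nat.div_add_mod L (r - 1)
  have h4 := Nat.mod_lt L (show 0 < r - 1 by omega)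
  refine ⟨L + 1, L / (r - 1) + 1, Nat.le_add_left _ _, h2, by rw [pow_succ]; omega, ?_, ?_⟩
  · rw [mul_add]
    omega
  · rw [Nat.add_sub_cancel]
    exact (Nat.pow_le_pow_right (by norm_num) (Nat.div_mul_le_self _ _)).trans h1

theorem exists_pair_gain_rpow {r m : ℕ} (hr : 2 ≤ r) (hm : 2 ^ 47 * r ^ 5 ≤ m)
    (u : Fin (r + 2) → List Bool) (hu : ∀ i b, (u i).count b = m) :
    ∃ i j, i ≠ j ∧ (m : ℝ) + (m : ℝ) ^ (1 - 1 / (r : ℝ)) / (2 ^ 48 * r ^ 5) ≤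
      pairLCS (u i) (u j) := by
  have hlen : ∀ i, (u i).length = 2 * m := fun i => by
    rw [← List.count_true_add_count_false, hu, hu]
    ring
  choose w hw using fun i => exists_wordPrefix_eq (u i)
  simp only [hlen] at hw
  have hcount : ∀ i b, letterCount (w i) b (2 * m) = m := fun i b => by
    rw [letterCount_eq_count, hw, hu]
  have hrR : (2 : ℝ) ≤ r := by exact_mod_cast hr
  set K : ℝ := 2 ^ 47 * r ^ 5 with hK
  have hK1 : 1 ≤ K := by
    have : (1 : ℝ) ≤ r ^ 5 := one_le_pow₀ (by linarith)
    rw [hK]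
    linarith
  have hmK : K ≤ m := by
    rw [hK]
    exact_mod_cast hm
  have hq1 : 1 ≤ (m : ℝ) / K := by rw [le_div_iff₀ (by linarith)]; linarith
  -- With `G` the integer part of `z ^ (r - 1)`, the scales satisfy `2 ^ ξ ≤ 4 * z`, so `2 ^ ξ * G`
  -- is of order at most `z ^ r = m / K`, as `exists_pair_gain` requires. Rounding costs at most a
  -- factor 2, whence `2 ^ 48`.
  set z : ℝ := ((m : ℝ) / K) ^ (1 / (r : ℝ)) with hz
  have hz1 : 1 ≤ z := Real.one_le_rpow hq1 (by positivity)
  have hzr : z ^ r = m / K := by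
    rw [hz, one_div, Real.rpow_inv_natCast_pow (by linarith) (by omega)]
  have hzr1 : z ^ (r - 1) = ((m : ℝ) / K) ^ (1 - 1 / (r : ℝ)) := by
    rw [hz, ← Real.rpow_natCast, ← Real.rpow_mul (by linarith), Nat.cast_sub (by omega)]
    congr 1
    field_simp
    simp
  set G := ⌊z ^ (r - 1)⌋₊ with hGdef
  have hG1 : 1 ≤ G := Nat.le_floor (by simpa using one_le_pow₀ hz1)
  have hGle : (G : ℝ) ≤ z ^ (r - 1) := Nat.floor_le (by positivity)
  have hGge : z ^ (r - 1) < G + 1 := Nat.lt_floor_add_one _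
  have hG1R : (1 : ℝ) ≤ G := by exact_mod_cast hG1
  obtain ⟨A, ξ, hξ, hA1, hA2, hA, hpow⟩ := exists_scales hr hG1
  have hξz : (2 : ℝ) ^ (ξ - 1) ≤ 2 * z := by
    refine le_of_pow_le_pow_left₀ (show r - 1 ≠ 0 by omega) (by positivity) ?_
    rw [← pow_mul]
    calc (2 : ℝ) ^ ((ξ - 1) * (r - 1)) ≤ 2 * G := by exact_mod_cast hpow
      _ ≤ 2 * z ^ (r - 1) := by linarith
      _ ≤ 2 ^ (r - 1) * z ^ (r - 1) := by
          gcongr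
          exact le_self_pow₀ (by norm_num) (by omega)
      _ = (2 * z) ^ (r - 1) := (mul_pow _ _ _).symm
  have hbig : (2 : ℝ) ^ 44 * r ^ 5 * 2 ^ ξ * G ≤ m := by
    have h1 : (2 : ℝ) ^ ξ ≤ 4 * z := by
      have : (2 : ℝ) ^ ξ = 2 ^ (ξ - 1) * 2 := by rw [← pow_succ]; congr 1; omega
      linarith
    calc (2 : ℝ) ^ 44 * r ^ 5 * 2 ^ ξ * G ≤ 2 ^ 44 * r ^ 5 * (4 * z) * z ^ (r - 1) := by gcongr
      _ = 2 ^ 46 * r ^ 5 * z ^ r := by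
          have : z ^ r = z ^ (r - 1) * z := by rw [← pow_succ]; congr 1; omega
          rw [this]
          ring
      _ = K * (m / K) / 2 := by rw [hzr, hK]; ring
      _ = m / 2 := by rw [mul_div_cancel₀ _ (by linarith : K ≠ 0)]
      _ ≤ m := half_le_self (Nat.cast_nonneg m)
  obtain ⟨i, j, hij, h⟩ := exists_pair_gain hr hG1 hξ hA1 hA2 hA (by exact_mod_cast hbig) w hcount
  rw [hw, hw] at h
  refine ⟨i, j, hij, ?_⟩
  have hR : (m : ℝ) + G ≤ pairLCS (u i) (u j) := by exact_mod_cast h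
  refine le_trans ?_ hR
  have hfrac : (m : ℝ) ^ (1 - 1 / (r : ℝ)) / K ≤ z ^ (r - 1) := by
    rw [hzr1, Real.div_rpow (Nat.cast_nonneg m) (by linarith)]
    refine div_le_div_of_nonneg_left (by positivity) (Real.rpow_pos_of_pos (by linarith) _) ?_
    refine (Real.rpow_le_rpow_of_exponent_le hK1 ?_).trans (Real.rpow_one K).le
    have : 0 ≤ 1 / (r : ℝ) := by positivity
    linarith
  have e : (m : ℝ) ^ (1 - 1 / (r : ℝ)) / (2 ^ 48 * r ^ 5) = (m : ℝ) ^ (1 - 1 / (r : ℝ)) / K / 2 := by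
    rw [hK, div_div]
    congr 1
    ring
  rw [e]
  linarith

/-- Two of three balanced binary words start with the same letter. -/
theorem exists_pair_gain_of_three {m : ℕ} (hm : 1 ≤ m) (u : Fin (1 + 2) → List Bool)
    (hu : ∀ i b, (u i).count b = m) : ∃ i j, i ≠ j ∧ m + 1 ≤ pairLCS (u i) (u j) := by
  have hcons : ∀ i, ∃ b v, u i = b :: v := fun i => by
    rcases h : u i with _ | ⟨b, v⟩
    · have := hu i true
      rw [h, List.count_nil] at this
      omega
    · exact ⟨b, v, rfl⟩
  choose b v hv using hcons
  obtain ⟨i, j, hij, hb⟩ := Fintype.exists_ne_map_eq_of_card_lt b (by simp)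
  refine ⟨i, j, hij, ?_⟩
  have hsub : ∀ l, (b l :: List.replicate m (!b l)).Sublist (u l) := fun l => by
    have := hu l (!b l)
    rw [hv, List.count_cons_of_ne (by simp)] at this
    rw [hv]
    exact (List.replicate_sublist_iff.2 this.ge).cons_cons _
  have := le_pairLCS (hsub i) (hb ▸ hsub j)
  simpa using this

/-! ### Reduction from `k` letters to two -/

theorem exists_pair_of_heavy {k : ℕ} {ι : Type*} (W : ι → List (Fin k)) (S : Finset ι)
    (hS : k < #S) (x : ℝ) (h : ∀ i ∈ S, ∃ a, x ≤ ((W i).count a : ℝ)) :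
    ∃ i j, i ≠ j ∧ x ≤ (pairLCS (W i) (W j) : ℝ) := by
  rcases S.eq_empty_or_nonempty with rfl | ⟨i₀, hi₀⟩
  · simp at hS
  have : Nonempty (Fin k) := ⟨(h i₀ hi₀).choose⟩
  choose! a ha using h
  obtain ⟨i, hi, j, hj, hij, hab⟩ := exists_ne_map_eq_of_card_lt_of_maps_to
    (s := S) (t := univ) (f := a) (by simpa using hS) (fun _ _ => by simp)
  refine ⟨i, j, hij, ?_⟩
  have h1 := ha i hi
  have h2 := ha j hj
  rw [← hab] at h2
  have h3 := count_le_pairLCS (a i) (W i) (W j) (min_le_left _ _) (min_le_right _ _)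
  have h4 : ((min ((W i).count (a i)) ((W j).count (a i)) : ℕ) : ℝ) ≤ pairLCS (W i) (W j) := by
    exact_mod_cast h3
  rw [Nat.cast_min] at h4
  exact (le_min h1 h2).trans h4

theorem sum_count_eq_length {k : ℕ} (w : List (Fin k)) : ∑ a, w.count a = w.length := by
  simpa using Multiset.sum_count_eq_card (s := univ) (m := (w : Multiset (Fin k)))
    (fun _ _ => mem_univ _)

theorem exists_map_sublist {α : Type*} [DecidableEq α] (φ : Bool → α)
    (hφ : φ true ≠ φ false) (w : List α) (p q : ℕ) (hp : p ≤ w.count (φ true))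
    (hq : q ≤ w.count (φ false)) :
    ∃ u : List Bool, u.count true = p ∧ u.count false = q ∧ (u.map φ).Sublist w := by
  induction w generalizing p q with
  | nil =>
    rw [List.count_nil] at hp hq
    exact ⟨[], by rw [List.count_nil]; omega, by rw [List.count_nil]; omega, by simp⟩
  | cons a w ih =>
    by_cases h1 : a = φ true ∧ 1 ≤ p
    · obtain ⟨rfl, hp1⟩ := h1
      rw [List.count_cons_self] at hp
      rw [List.count_cons_of_ne hφ] at hq
      obtain ⟨u, e1, e2, e3⟩ := ih (p - 1) q (by omega) hq
      exact ⟨true :: u, by simp [e1]; omega, by simpa using e2, by simpa using e3⟩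
    · by_cases h2 : a = φ false ∧ 1 ≤ q
      · obtain ⟨rfl, hq1⟩ := h2
        rw [List.count_cons_self] at hq
        rw [List.count_cons_of_ne hφ.symm] at hp
        obtain ⟨u, e1, e2, e3⟩ := ih p (q - 1) hp (by omega)
        exact ⟨false :: u, by simpa using e1, by simp [e2]; omega, by simpa using e3⟩
      · have hp' : p ≤ w.count (φ true) := by
          by_cases ha : a = φ true
          · have : p = 0 := by
              by_contra hne
              exact h1 ⟨ha, by omega⟩
            omega
          · rwa [List.count_cons_of_ne ha] at hp
        have hq' : q ≤ w.count (φ false) := by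
          by_cases ha : a = φ false
          · have : q = 0 := by
              by_contra hne
              exact h2 ⟨ha, by omega⟩
            omega
          · rwa [List.count_cons_of_ne ha] at hq
        obtain ⟨u, e1, e2, e3⟩ := ih p q hp' hq'
        exact ⟨u, e1, e2, e3.cons a⟩

theorem pairLCS_le_pairLCS_map {α β : Type*} (φ : α → β) (u u' : List α) :
    pairLCS u u' ≤ pairLCS (u.map φ) (u'.map φ) := by
  obtain ⟨v, h1, h2, h3⟩ := exists_sublist_length_eq_pairLCS u u'
  have := le_pairLCS (h1.map φ) (h2.map φ)
  rwa [List.length_map, h3] at this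

/-- Reduction of the `k`-letter problem to the binary problem. -/
theorem exists_pair_of_binary {k r n : ℕ} (hk : 2 ≤ k) {g : ℝ}
    (H : ∀ m : ℕ, (n : ℝ) / k - g ≤ m → ∀ u : Fin (r + 2) → List Bool,
      (∀ i b, (u i).count b = m) → ∃ i j, i ≠ j ∧ m + g ≤ (pairLCS (u i) (u j) : ℝ))
    (W : Fin (r + k + 2) → List (Fin k)) (hW : ∀ i, (W i).length = n) (hg : 0 ≤ g) :
    ∃ i j, i ≠ j ∧ (n : ℝ) / k + g / k ≤ (pairLCS (W i) (W j) : ℝ) := by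
  classical
  set S : Finset (Fin (r + k + 2)) :=
    univ.filter fun i => ∃ a, (n : ℝ) / k + g / k ≤ ((W i).count a : ℝ) with hS
  by_cases hcard : k < #S
  · exact exists_pair_of_heavy W S hcard _ fun i hi => by simpa [hS] using hi
  have hkR : (2 : ℝ) ≤ k := by exact_mod_cast hk
  have hcompl : r + 2 ≤ #Sᶜ := by
    rw [card_compl, Fintype.card_fin]
    omega
  obtain ⟨T, hTS, hT⟩ := exists_subset_card_eq hcompl
  set ψ := T.orderEmbOfFin hT
  have hψ : ∀ i a, ((W (ψ i)).count a : ℝ) < (n : ℝ) / k + g / k := by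
    intro i a
    have := hTS (orderEmbOfFin_mem T hT i)
    simp only [hS, mem_compl, mem_filter, mem_univ, true_and, not_exists, not_le] at this
    exact this a
  -- If every letter stays below `n/k + g/k`, the other `k - 1` letters leave at least this many
  -- places for each one. Then `m + g ≥ n/k + g/k`, so the binary gain `g` shrinks exactly to `g /
  -- k`.
  set m := ⌈(n : ℝ) / k - (k - 1) * (g / k)⌉₊ with hm
  have hcount : ∀ i a, m ≤ (W (ψ i)).count a := by
    intro i a
    refine Nat.ceil_le.2 ?_
    have h1 : ∑ b, ((W (ψ i)).count b : ℝ) = n := by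
      rw [← Nat.cast_sum, sum_count_eq_length, hW]
    rw [← add_sum_erase univ _ (mem_univ a)] at h1
    have h2 : ∑ b ∈ univ.erase a, ((W (ψ i)).count b : ℝ) ≤
        ∑ b ∈ univ.erase a, ((n : ℝ) / k + g / k) := sum_le_sum fun b _ => (hψ i b).le
    rw [sum_const, card_erase_of_mem (mem_univ a), card_univ, Fintype.card_fin, nsmul_eq_mul,
      Nat.cast_sub (by omega), Nat.cast_one] at h2
    have h3 : ((k : ℝ) - 1) * ((n : ℝ) / k + g / k) = n - n / k + (k - 1) * (g / k) := by
      field_simp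
    linarith
  have hgk : (k : ℝ) * (g / k) = g := by field_simp
  have hm1 : (n : ℝ) / k - (k - 1) * (g / k) ≤ m := Nat.le_ceil _
  have hgk0 : 0 ≤ g / k := by positivity
  set φ : Bool → Fin k := fun b => if b then ⟨0, by omega⟩ else ⟨1, by omega⟩
  choose u hu1 hu2 hu3 using fun i => exists_map_sublist φ (by simp [φ]) (W (ψ i)) m m
    (hcount i _) (hcount i _)
  obtain ⟨i, j, hij, h⟩ := H m (by linarith) u (fun i b => by cases b <;> simp [hu1, hu2])
  refine ⟨ψ i, ψ j, fun he => hij (ψ.injective he), ?_⟩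
  have h4 : pairLCS (u i) (u j) ≤ pairLCS (W (ψ i)) (W (ψ j)) :=
    (pairLCS_le_pairLCS_map φ _ _).trans (pairLCS_mono (hu3 i) (hu3 j))
  have h5 : (pairLCS (u i) (u j) : ℝ) ≤ pairLCS (W (ψ i)) (W (ψ j)) := by exact_mod_cast h4
  linarith

theorem le_minLCS {k t n : ℕ} (hk : 1 ≤ k) (ht : 2 ≤ t) {x : ℝ}
    (h : ∀ W : Fin t → List (Fin k), (∀ i, (W i).length = n) →
      ∃ i j, i ≠ j ∧ x ≤ (pairLCS (W i) (W j) : ℝ)) :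
    x ≤ (minLCS t (words k n) : ℝ) := by
  have hne : (words k n).Nonempty := ⟨List.replicate n ⟨0, hk⟩, by simp [words]⟩
  obtain ⟨W, hW, he⟩ := (minLCS_isLeast t hne).1
  obtain ⟨i, j, hij, hx⟩ := h W hW
  have : Nontrivial (Fin t) := Fin.nontrivial_iff_two_le.2 ht
  rw [← he]
  exact hx.trans (Nat.cast_le.2 ((familyLCS_isGreatest W).2 ⟨i, j, hij, rfl⟩))

theorem threshold_le {r : ℕ} (hr : 2 ≤ r) : (2 ^ 48 * r ^ 5 : ℝ) ≤ (10 * r) ^ (9 * r) := by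
  have hrR : (2 : ℝ) ≤ r := by exact_mod_cast hr
  calc (2 ^ 48 * r ^ 5 : ℝ) ≤ 10 ^ 18 * r ^ 18 := by
        gcongr
        · norm_num
        · linarith
        · norm_num
    _ = (10 * r) ^ 18 := (mul_pow _ _ _).symm
    _ ≤ (10 * r) ^ (9 * r) := pow_le_pow_right₀ (by linarith) (by omega)

/-- The gain for `r + 2` balanced binary words, expressed through the average letter count. -/
theorem binary_gain {r m : ℕ} (hr : 1 ≤ r) {N g : ℝ} (hN : (10 * r : ℝ) ^ (9 * r) ≤ N)
    (hg : g = (2 ^ 49 : ℝ)⁻¹ * ((r : ℝ) ^ 9)⁻¹ * N ^ (1 - 1 / (r : ℝ))) (hm : N - g ≤ m)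
    (u : Fin (r + 2) → List Bool) (hu : ∀ i b, (u i).count b = m) :
    ∃ i j, i ≠ j ∧ m + g ≤ (pairLCS (u i) (u j) : ℝ) := by
  have hr1 : (1 : ℝ) ≤ r := by exact_mod_cast hr
  have hN1 : 1 ≤ N := le_trans (one_le_pow₀ (by linarith)) hN
  have hexp0 : 0 ≤ 1 - 1 / (r : ℝ) := by
    rw [sub_nonneg, div_le_one (by linarith)]
    exact hr1
  have hexp1 : 1 - 1 / (r : ℝ) ≤ 1 := by
    have : 0 ≤ 1 / (r : ℝ) := by positivity
    linarith
  set y := N ^ (1 - 1 / (r : ℝ)) with hy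
  have hy0 : 0 ≤ y := by positivity
  have hyN : y ≤ N := (Real.rpow_le_rpow_of_exponent_le hN1 hexp1).trans (Real.rpow_one N).le
  have hr9 : ((r : ℝ) ^ 9)⁻¹ ≤ 1 := inv_le_one_of_one_le₀ (one_le_pow₀ hr1)
  have hr9' : 0 < ((r : ℝ) ^ 9)⁻¹ := by positivity
  have hgy : g ≤ (2 ^ 49 : ℝ)⁻¹ * y := by
    rw [hg]
    have : (2 ^ 49 : ℝ)⁻¹ * ((r : ℝ) ^ 9)⁻¹ ≤ (2 ^ 49 : ℝ)⁻¹ :=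
      mul_le_of_le_one_right (by positivity) hr9
    exact mul_le_mul_of_nonneg_right this hy0
  have hgN : g ≤ N / 2 := by linarith
  have hmN : N / 2 ≤ m := by linarith
  -- For `r = 1` there would be no bins of scales, but the exponent is 0, so a gain of 1 is enough.
  rcases Nat.lt_or_ge r 2 with h | h
  · obtain rfl : r = 1 := by omega
    have hm1 : 1 ≤ m := by
      have : (0 : ℝ) < m := by linarith
      exact_mod_cast this
    obtain ⟨i, j, hij, hl⟩ := exists_pair_gain_of_three hm1 u hu
    refine ⟨i, j, hij, ?_⟩
    have hl' : (m : ℝ) + 1 ≤ pairLCS (u i) (u j) := by exact_mod_cast hl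
    have : y = 1 := by simp [hy]
    rw [this] at hgy
    have hg1 : g ≤ 1 := hgy.trans (by norm_num)
    exact le_trans (by gcongr) hl'
  · have hthr := threshold_le h
    have hm47 : 2 ^ 47 * r ^ 5 ≤ m := by
      have : (2 ^ 47 * r ^ 5 : ℝ) ≤ m := by linarith
      exact_mod_cast this
    obtain ⟨i, j, hij, hl⟩ := exists_pair_gain_rpow h hm47 u hu
    refine ⟨i, j, hij, le_trans ?_ hl⟩
    have hmy : y / 2 ≤ (m : ℝ) ^ (1 - 1 / (r : ℝ)) := by
      refine le_trans ?_ (Real.rpow_le_rpow (by linarith) hmN hexp0)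
      rw [Real.div_rpow (by linarith) (by norm_num)]
      refine div_le_div_of_nonneg_left hy0 (Real.rpow_pos_of_pos (by norm_num) _) ?_
      exact (Real.rpow_le_rpow_of_exponent_le (by norm_num) hexp1).trans (Real.rpow_one 2).le
    -- The binary estimate loses only `r ^ 5`, which leaves room in the exponent 9.
    have h5 : ((r : ℝ) ^ 9)⁻¹ ≤ ((r : ℝ) ^ 5)⁻¹ :=
      inv_anti₀ (by positivity) (pow_le_pow_right₀ hr1 (by norm_num))
    have : g ≤ (m : ℝ) ^ (1 - 1 / (r : ℝ)) / (2 ^ 48 * r ^ 5) := by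
      calc g ≤ (2 ^ 49 : ℝ)⁻¹ * ((r : ℝ) ^ 5)⁻¹ * y := by rw [hg]; gcongr
        _ = y / 2 / (2 ^ 48 * r ^ 5) := by field_simp
        _ ≤ _ := by gcongr
    linarith

end CommonSubseq

theorem theorem1 :
    (∃ C₁ C₂ : ℝ, 0 < C₁ ∧ C₁ ≤ C₂ ∧
      ∀ k r : ℕ, 2 ≤ k → 1 ≤ r →
        ∃ c : ℝ,
          C₁ * (((r : ℝ) ^ 9)⁻¹ * (k : ℝ) ^ (1 / (r : ℝ) - 2)) ≤ c ∧
          c ≤ C₂ * (((r : ℝ) ^ 9)⁻¹ * (k : ℝ) ^ (1 / (r : ℝ) - 2)) ∧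
          ∀ n : ℕ, k * (10 * r) ^ (9 * r) ≤ n →
            (n : ℝ) / (k : ℝ) + c * (n : ℝ) ^ (1 - 1 / (r : ℝ)) ≤
              (CommonSubseq.minLCS (r + k + 2) (CommonSubseq.words k n) : ℝ)) ∧
    (∀ k n : ℕ, 2 ≤ k → k ≤ n →
      (n : ℝ) / (k : ℝ) ≤
        (CommonSubseq.minLCS (k + 2) (CommonSubseq.words k n) : ℝ)) := by
  refine ⟨⟨(2 ^ 49)⁻¹, (2 ^ 49)⁻¹, by positivity, le_rfl, fun k r hk hr =>
    ⟨_, le_rfl, le_rfl, fun n hn => ?_⟩⟩, fun k n hk _ => ?_⟩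
  · have hk0 : (0 : ℝ) < k := by exact_mod_cast (by omega : 0 < k)
    have hN : (10 * r : ℝ) ^ (9 * r) ≤ (n : ℝ) / k := by
      rw [le_div_iff₀' hk0]
      exact_mod_cast hn
    have hg : (0 : ℝ) ≤ (2 ^ 49 : ℝ)⁻¹ * ((r : ℝ) ^ 9)⁻¹ * ((n : ℝ) / k) ^ (1 - 1 / (r : ℝ)) := by
      positivity
    -- The factor `k ^ (1/r - 2)` is `k ^ (-(1 - 1/r))`, from the average count `n / k`, times
    -- `k⁻¹`, from the passage to two letters.
    have e : (2 ^ 49 : ℝ)⁻¹ * (((r : ℝ) ^ 9)⁻¹ * (k : ℝ) ^ (1 / (r : ℝ) - 2)) *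
        (n : ℝ) ^ (1 - 1 / (r : ℝ)) =
        (2 ^ 49 : ℝ)⁻¹ * ((r : ℝ) ^ 9)⁻¹ * ((n : ℝ) / k) ^ (1 - 1 / (r : ℝ)) / k := by
      have hpow : (k : ℝ) ^ (1 / (r : ℝ) - 2) = ((k : ℝ) ^ (1 - 1 / (r : ℝ)))⁻¹ / k := by
        rw [← Real.rpow_neg hk0.le, ← Real.rpow_sub_one hk0.ne']
        congr 1
        ring
      rw [hpow, Real.div_rpow (Nat.cast_nonneg n) hk0.le]
      ring
    rw [e]
    refine CommonSubseq.le_minLCS (by omega) (by omega) fun W hW => ?_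
    exact CommonSubseq.exists_pair_of_binary hk
      (fun m hm u hu => CommonSubseq.binary_gain hr hN rfl hm u hu) W hW hg
  · refine CommonSubseq.le_minLCS (by omega) (by omega) fun W hW => ?_
    have hk0 : (0 : ℝ) < k := by exact_mod_cast (by omega : 0 < k)
    -- Every word has a letter of at least average frequency, and there are more words than letters.
    refine CommonSubseq.exists_pair_of_heavy W Finset.univ (by simp) _ fun i _ => ?_
    by_contra! hcon
    have : Nonempty (Fin k) := ⟨⟨0, by omega⟩⟩
    have h1 : ∑ a, ((W i).count a : ℝ) < ∑ _a : Fin k, (n : ℝ) / k :=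
      Finset.sum_lt_sum_of_nonempty Finset.univ_nonempty fun a _ => hcon a
    rw [← Nat.cast_sum, CommonSubseq.sum_count_eq_length, hW, Finset.sum_const, Finset.card_univ,
      Fintype.card_fin, nsmul_eq_mul, mul_div_cancel₀ _ hk0.ne'] at h1
    exact lt_irrefl _ h1
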